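/- Let $(M,g)$ be a spacetime: a smooth Hausdorff second countable manifold $M$ (without boundary) with a smooth Lorentzian metric $g$ of signature $(-,+,\dots,+)$ and a time orientation (given by a continuous timelike vector field). Let $I^{\pm}(x)$ be the chronological future and past of $x$, defined by piecewise smooth timelike curves, let $\operatorname{vol}_g$ be the volume measure of $g$ (density $\sqrt{|\det g_{ij}|}$ in charts), and let $$\tau(x) := \operatorname{vol}_g(I^-(x)) \in [0,\infty]$$ be the cosmological volume function. Suppose that $\tau$ is regular, that is, $\tau(x)<\infty$ for all $x\in M$, and $\tau\to 0$ towards the past along every past-inextendible (piecewise smooth) causal curve, i.e. every future-directed causal curve whose points have no limit in $M$ towards the past end of its parameter interval. Then: 1. $\tau$ is continuous on $M$; 2. $\tau$ is (weakly) monotonically increasing along every future-directed causal curve, whether piecewise smooth or only continuous (a continuous curve, defined on an interval, is future-directed causal if locally, within any given neighbourhood of each of its points, any two of its points are joined, in the right order, by a future-directed piecewise smooth causal curve); 3. $(M,g)$ is past reflecting: for all $x,y\in M$, if $I^+(y)\subseteq I^+(x)$, then $I^-(x)\subseteq I^-(y)$. -/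

import Mathlib

open Set Filter Topology MeasureTheory Bundle
open scoped Manifold ContDiff ENNReal

set_option linter.unusedSectionVars false

noncomputable section

/-- A spacetime structure on a smooth manifold `M` of dimension `n + 1` (without boundary): a smooth
Lorentzian metric of signature `(-, +, …, +)` together with a time orientation, given by a
continuous timelike vector field. -/
structure Spacetime (n : ℕ) (M : Type*) [TopologicalSpace M]
    [ChartedSpace (EuclideanSpace ℝ (Fin (n + 1))) M] [IsManifold (𝓡 (n + 1)) ∞ M] where
  /-- The metric tensor. -/
  metric : ∀ x : M, TangentSpace (𝓡 (n + 1)) x →L[ℝ] TangentSpace (𝓡 (n + 1)) x →L[ℝ] ℝ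
  metric_symm : ∀ (x : M) (v w : TangentSpace (𝓡 (n + 1)) x), metric x v w = metric x w v
  metric_signature : ∀ x : M, ∃ b : Module.Basis (Fin (n + 1)) ℝ (TangentSpace (𝓡 (n + 1)) x),
    ∀ i j, metric x (b i) (b j) = if i = j then (if i = 0 then -1 else 1) else 0
  metric_contMDiff : ContMDiff (𝓡 (n + 1))
    ((𝓡 (n + 1)).prod 𝓘(ℝ, EuclideanSpace ℝ (Fin (n + 1)) →L[ℝ]
      EuclideanSpace ℝ (Fin (n + 1)) →L[ℝ] ℝ)) ∞
    (fun x ↦ TotalSpace.mk' (EuclideanSpace ℝ (Fin (n + 1)) →L[ℝ]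
      EuclideanSpace ℝ (Fin (n + 1)) →L[ℝ] ℝ) x (metric x))
  /-- The vector field that singles out the future cones. -/
  timeField : ∀ x : M, TangentSpace (𝓡 (n + 1)) x
  timeField_continuous :
    Continuous (fun x ↦ (⟨x, timeField x⟩ : TangentBundle (𝓡 (n + 1)) M))
  timeField_timelike : ∀ x : M, metric x (timeField x) (timeField x) < 0

namespace Spacetime

variable {n : ℕ} {M : Type*} [TopologicalSpace M]
  [ChartedSpace (EuclideanSpace ℝ (Fin (n + 1))) M] [IsManifold (𝓡 (n + 1)) ∞ M]

/-! ### Causal structure -/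

/-- Future-directed timelike tangent vectors. -/
def IsFutureTimelike (S : Spacetime n M) (x : M) (v : TangentSpace (𝓡 (n + 1)) x) : Prop :=
  S.metric x v v < 0 ∧ S.metric x v (S.timeField x) < 0

/-- Future-directed causal (nonzero, timelike or null) tangent vectors. -/
def IsFutureCausal (S : Spacetime n M) (x : M) (v : TangentSpace (𝓡 (n + 1)) x) : Prop :=
  v ≠ 0 ∧ S.metric x v v ≤ 0 ∧ S.metric x v (S.timeField x) < 0

/-- The velocity at time `t` of a curve defined on `[a, b]` (one-sided at the end points). -/
def velocity (γ : ℝ → M) (a b t : ℝ) : TangentSpace (𝓡 (n + 1)) (γ t) :=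
  mfderivWithin 𝓘(ℝ, ℝ) (𝓡 (n + 1)) γ (Icc a b) t (1 : ℝ)

/-- `γ` is piecewise smooth on `[a, b]`, where `a < b`, and on each of the finitely many closed
pieces its velocity satisfies `P`. -/
def PiecewiseSmooth (P : ∀ x : M, TangentSpace (𝓡 (n + 1)) x → Prop) (γ : ℝ → M) (a b : ℝ) :
    Prop :=
  a < b ∧ ∃ (k : ℕ) (t : ℕ → ℝ), t 0 = a ∧ t k = b ∧ ∀ i < k, t i < t (i + 1) ∧
    ContMDiffOn 𝓘(ℝ, ℝ) (𝓡 (n + 1)) ∞ γ (Icc (t i) (t (i + 1))) ∧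
    ∀ s ∈ Icc (t i) (t (i + 1)), P (γ s) (velocity γ (t i) (t (i + 1)) s)

/-- The chronological past `I⁻(x)`: the starting points of future-directed timelike curves that
end at `x`. -/
def chronPast (S : Spacetime n M) (x : M) : Set M :=
  {z | ∃ (γ : ℝ → M) (a b : ℝ), PiecewiseSmooth S.IsFutureTimelike γ a b ∧ γ a = z ∧ γ b = x}

/-- The chronological future `I⁺(x)`. -/
def chronFuture (S : Spacetime n M) (x : M) : Set M :=
  {z | ∃ (γ : ℝ → M) (a b : ℝ), PiecewiseSmooth S.IsFutureTimelike γ a b ∧ γ a = x ∧ γ b = z}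

/-- A future-directed, piecewise smooth causal curve defined on the interval `J` (of any type:
open, closed, half-open, bounded or not); the break points may accumulate only at end points that
are not in `J`. -/
def IsCausalCurve (S : Spacetime n M) (γ : ℝ → M) (J : Set ℝ) : Prop :=
  J.OrdConnected ∧ ∀ a ∈ J, ∀ b ∈ J, a < b → PiecewiseSmooth S.IsFutureCausal γ a b

/-- A future-directed continuous causal curve defined on the interval `J`: locally, any two of its
points are joined, in the right order and inside any given neighbourhood, by a future-directed
piecewise smooth causal curve. -/
def IsContinuousCausalCurve (S : Spacetime n M) (γ : ℝ → M) (J : Set ℝ) : Prop :=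
  J.OrdConnected ∧ ContinuousOn γ J ∧ ∀ t₀ ∈ J, ∀ U ∈ 𝓝 (γ t₀), ∃ V ∈ 𝓝[J] t₀,
    ∀ s ∈ V ∩ J, ∀ t ∈ V ∩ J, s < t → ∃ (σ : ℝ → M) (a b : ℝ),
      PiecewiseSmooth S.IsFutureCausal σ a b ∧ σ a = γ s ∧ σ b = γ t ∧ MapsTo σ (Icc a b) U

theorem PiecewiseSmooth.continuousOn {P : ∀ x : M, TangentSpace (𝓡 (n + 1)) x → Prop}
    {γ : ℝ → M} {a b : ℝ} (h : PiecewiseSmooth P γ a b) : ContinuousOn γ (Icc a b) := by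
  obtain ⟨-, k, t, h0, hk, ht⟩ := h
  have key : ∀ j ≤ k, t 0 ≤ t j ∧ ContinuousOn γ (Icc (t 0) (t j)) := by
    intro j
    induction j with
    | zero => intro _; simp
    | succ j ih =>
      intro hj
      obtain ⟨hle, hc⟩ := ih (by omega)
      obtain ⟨hlt, hs, -⟩ := ht j (by omega)
      refine ⟨hle.trans hlt.le, ?_⟩
      rw [← Icc_union_Icc_eq_Icc hle hlt.le]
      exact hc.union_of_isClosed hs.continuousOn isClosed_Icc isClosed_Icc
  have := (key k le_rfl).2
  rwa [h0, hk] at this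

/-- Piecewise smooth causal curves are continuous causal curves. -/
theorem IsCausalCurve.isContinuousCausalCurve {S : Spacetime n M} {γ : ℝ → M} {J : Set ℝ}
    (h : S.IsCausalCurve γ J) : S.IsContinuousCausalCurve γ J := by
  have hc : ContinuousOn γ J := by
    intro t ht
    have hl : ∀ a ∈ J, a < t → ContinuousWithinAt γ (Icc a t) t := fun a ha hat ↦
      (h.2 a ha t ht hat).continuousOn t ⟨hat.le, le_rfl⟩
    have hr : ∀ b ∈ J, t < b → ContinuousWithinAt γ (Icc t b) t := fun b hb htb ↦
      (h.2 t ht b hb htb).continuousOn t ⟨le_rfl, htb.le⟩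
    have hJ : J = (J ∩ Iic t) ∪ (J ∩ Ici t) := by
      rw [← inter_union_distrib_left, Iic_union_Ici, inter_univ]
    rw [hJ, continuousWithinAt_union]
    constructor
    · by_cases ha : ∃ a ∈ J, a < t
      · obtain ⟨a, ha, hat⟩ := ha
        refine (hl a ha hat).mono_of_mem_nhdsWithin ?_
        filter_upwards [self_mem_nhdsWithin, mem_nhdsWithin_of_mem_nhds (Ioi_mem_nhds hat)]
          with s hs hs'
        exact ⟨le_of_lt hs', hs.2⟩
      · push Not at ha
        refine (continuousWithinAt_singleton (f := γ) (x := t)).mono ?_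
        rintro s ⟨hs, hst⟩
        exact le_antisymm hst (ha s hs)
    · by_cases hb : ∃ b ∈ J, t < b
      · obtain ⟨b, hb, htb⟩ := hb
        refine (hr b hb htb).mono_of_mem_nhdsWithin ?_
        filter_upwards [self_mem_nhdsWithin, mem_nhdsWithin_of_mem_nhds (Iio_mem_nhds htb)]
          with s hs hs'
        exact ⟨hs.2, le_of_lt hs'⟩
      · push Not at hb
        refine (continuousWithinAt_singleton (f := γ) (x := t)).mono ?_
        rintro s ⟨hs, hst⟩
        exact le_antisymm (hb s hs) hst
  refine ⟨h.1, hc, fun t₀ ht₀ U hU ↦ ?_⟩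
  have hV := hc t₀ ht₀ hU
  rw [Filter.mem_map] at hV
  obtain ⟨ε, hε, hsub⟩ := Metric.mem_nhdsWithin_iff.1 hV
  refine ⟨Metric.ball t₀ ε, mem_nhdsWithin_of_mem_nhds (Metric.ball_mem_nhds _ hε), ?_⟩
  rintro s ⟨hs, hsJ⟩ t ⟨ht, htJ⟩ hst
  refine ⟨γ, s, t, h.2 s hsJ t htJ hst, rfl, rfl, fun r hr ↦ ?_⟩
  refine hsub ⟨?_, h.1.out hsJ htJ hr⟩
  rw [Real.ball_eq_Ioo] at hs ht ⊢
  exact ⟨hs.1.trans_le hr.1, hr.2.trans_lt ht.2⟩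

/-- A past-inextendible causal curve: its points do not converge as the parameter decreases to the
left end of `J`. (If `J` has a least element `a`, then `γ a` is a past end point, since `atBot` is
then the principal filter of `a`.) -/
def IsPastInextendible (S : Spacetime n M) (γ : ℝ → M) (J : Set ℝ) : Prop :=
  S.IsCausalCurve γ J ∧ ¬ ∃ p : M, Tendsto (fun t : J ↦ γ t) atBot (𝓝 p)

/-- `I⁺(y) ⊆ I⁺(x)` implies `I⁻(x) ⊆ I⁻(y)`. -/
def IsPastReflecting (S : Spacetime n M) : Prop :=
  ∀ x y : M, S.chronFuture y ⊆ S.chronFuture x → S.chronPast x ⊆ S.chronPast y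

/-! ### Volume -/

/-- The Gram matrix `g_{ij}` of the metric in the chart `e`, at the point with coordinates `u`. -/
def gram (S : Spacetime n M) (e : OpenPartialHomeomorph M (EuclideanSpace ℝ (Fin (n + 1))))
    (u : EuclideanSpace ℝ (Fin (n + 1))) : Matrix (Fin (n + 1)) (Fin (n + 1)) ℝ :=
  Matrix.of fun i j ↦ S.metric (e.symm u)
    (mfderiv (𝓡 (n + 1)) (𝓡 (n + 1)) e.symm u (EuclideanSpace.single i (1 : ℝ)))
    (mfderiv (𝓡 (n + 1)) (𝓡 (n + 1)) e.symm u (EuclideanSpace.single j (1 : ℝ)))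

/-- The volume density `√|det g_{ij}|` in the chart `e`. -/
def density (S : Spacetime n M) (e : OpenPartialHomeomorph M (EuclideanSpace ℝ (Fin (n + 1))))
    (u : EuclideanSpace ℝ (Fin (n + 1))) : ℝ≥0∞ :=
  ENNReal.ofReal (Real.sqrt |(S.gram e u).det|)

variable [MeasurableSpace M]

/-- The measure with density `√|det g_{ij}|` in the chart `e`, transported to the domain of `e`
(and zero outside of it). -/
def chartVol (S : Spacetime n M) (e : OpenPartialHomeomorph M (EuclideanSpace ℝ (Fin (n + 1)))) :
    Measure M :=
  ((volume.restrict e.target).withDensity (S.density e)).map e.symm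

/-- The volume measure `vol_g`: the supremum of the measures `√|det g_{ij}| dx` over all smooth
charts. As `vol_apply` shows, it is the Borel measure given by `∫ √|det g_{ij}| dx` in any
chart. -/
def vol (S : Spacetime n M) : Measure M :=
  ⨆ e ∈ IsManifold.maximalAtlas (𝓡 (n + 1)) ∞ M, S.chartVol e

/-- The cosmological volume function `τ(x) = vol_g (I⁻(x))`. -/
def cosmologicalVolume (S : Spacetime n M) (x : M) : ℝ≥0∞ :=
  S.vol (S.chronPast x)

/-- Regularity of the cosmological volume function: it is finite, and it tends to zero (towards
the past) along all past-inextendible causal curves. -/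
def HasRegularCosmologicalVolume (S : Spacetime n M) : Prop :=
  (∀ x : M, S.cosmologicalVolume x < ⊤) ∧
  ∀ (γ : ℝ → M) (J : Set ℝ), S.IsPastInextendible γ J →
    Tendsto (fun t : J ↦ S.cosmologicalVolume (γ t)) atBot (𝓝 0)

/-! ### The volume measure is given by the same formula in every chart -/

theorem chartVol_apply [BorelSpace M] (S : Spacetime n M)
    (e : OpenPartialHomeomorph M (EuclideanSpace ℝ (Fin (n + 1)))) {A : Set M}
    (hA : MeasurableSet A) :
    S.chartVol e A = ∫⁻ u in e.target ∩ e.symm ⁻¹' A, S.density e u := by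
  have hm : AEMeasurable e.symm (volume.restrict e.target) :=
    e.continuousOn_symm.aemeasurable e.open_target.measurableSet
  rw [chartVol, Measure.map_apply_of_aemeasurable
    (hm.mono_ac (withDensity_absolutelyContinuous _ _)) hA, withDensity_apply',
    Measure.restrict_restrict' e.open_target.measurableSet, inter_comm]

theorem density_eq (S : Spacetime n M)
    {e f : OpenPartialHomeomorph M (EuclideanSpace ℝ (Fin (n + 1)))}
    (he : e ∈ IsManifold.maximalAtlas (𝓡 (n + 1)) ∞ M)
    {u : EuclideanSpace ℝ (Fin (n + 1))} (hu : u ∈ f.target) (hue : f.symm u ∈ e.source)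
    {L : EuclideanSpace ℝ (Fin (n + 1)) →L[ℝ] EuclideanSpace ℝ (Fin (n + 1))}
    (hL : HasFDerivAt (e ∘ f.symm) L u) :
    S.density f u = ENNReal.ofReal |L.det| * S.density e (e (f.symm u)) := by
  -- all tangent spaces are copies of the model space, which avoids casts between them
  let m : M → EuclideanSpace ℝ (Fin (n + 1)) →L[ℝ] EuclideanSpace ℝ (Fin (n + 1)) →L[ℝ] ℝ :=
    fun x ↦ S.metric x
  let De : EuclideanSpace ℝ (Fin (n + 1)) →L[ℝ] EuclideanSpace ℝ (Fin (n + 1)) :=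
    mfderiv (𝓡 (n + 1)) (𝓡 (n + 1)) e.symm (e (f.symm u))
  let Df : EuclideanSpace ℝ (Fin (n + 1)) →L[ℝ] EuclideanSpace ℝ (Fin (n + 1)) :=
    mfderiv (𝓡 (n + 1)) (𝓡 (n + 1)) f.symm u
  have hD : Df = De.comp L := by
    have h1 : HasMFDerivAt (𝓡 (n + 1)) (𝓡 (n + 1)) (e ∘ f.symm) u L := hL.hasMFDerivAt
    have h2 := ((contMDiffAt_symm_of_mem_maximalAtlas he
      (e.map_source hue)).mdifferentiableAt (by simp)).hasMFDerivAt
    have h3 := HasMFDerivAt.comp u h2 h1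
    have h4 : f.symm =ᶠ[𝓝 u] e.symm ∘ (e ∘ f.symm) := by
      have := (f.continuousAt_symm hu).preimage_mem_nhds (e.open_source.mem_nhds hue)
      filter_upwards [this] with v hv
      exact (e.left_inv hv).symm
    exact (h3.congr_of_eventuallyEq h4).mfderiv
  let b := (EuclideanSpace.basisFun (Fin (n + 1)) ℝ).toBasis
  let A := LinearMap.toMatrix b b (L : EuclideanSpace ℝ (Fin (n + 1)) →ₗ[ℝ] _)
  have hA : ∀ i, L (EuclideanSpace.single i (1 : ℝ))
      = ∑ k, A k i • EuclideanSpace.single k (1 : ℝ) := by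
    intro i
    have := b.sum_repr (L (EuclideanSpace.single i (1 : ℝ)))
    rw [← this]
    refine Finset.sum_congr rfl fun k _ ↦ ?_
    simp [A, b, LinearMap.toMatrix_apply]
  have hG : S.gram f u = A.transpose * S.gram e (e (f.symm u)) * A := by
    ext i j
    have hl : S.gram f u i j = m (f.symm u) (Df (EuclideanSpace.single i (1 : ℝ)))
      (Df (EuclideanSpace.single j (1 : ℝ))) := rfl
    have hr : ∀ k l, S.gram e (e (f.symm u)) k l =
        m (e.symm (e (f.symm u))) (De (EuclideanSpace.single k (1 : ℝ)))
          (De (EuclideanSpace.single l (1 : ℝ))) := fun _ _ ↦ rfl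
    rw [e.left_inv hue] at hr
    rw [hl, hD, ContinuousLinearMap.comp_apply, ContinuousLinearMap.comp_apply, hA i, hA j]
    simp only [map_sum, map_smul, _root_.sum_apply, _root_.smul_apply,
      Matrix.mul_apply, Matrix.transpose_apply, hr, smul_eq_mul, Finset.mul_sum, Finset.sum_mul]
    refine Finset.sum_congr rfl fun k _ ↦ Finset.sum_congr rfl fun l _ ↦ ?_
    ring
  have hdet : A.det = L.det := by
    rw [ContinuousLinearMap.det, ← LinearMap.det_toMatrix b]
  rw [density, density, ← ENNReal.ofReal_mul (abs_nonneg _), hG, Matrix.det_mul, Matrix.det_mul,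
    Matrix.det_transpose, hdet]
  congr 1
  rw [show L.det * (S.gram e (e (f.symm u))).det * L.det
      = L.det ^ 2 * (S.gram e (e (f.symm u))).det by ring, abs_mul, abs_pow,
    Real.sqrt_mul (by positivity), Real.sqrt_sq (abs_nonneg _)]

theorem chartVol_eq [BorelSpace M] (S : Spacetime n M)
    {e f : OpenPartialHomeomorph M (EuclideanSpace ℝ (Fin (n + 1)))}
    (he : e ∈ IsManifold.maximalAtlas (𝓡 (n + 1)) ∞ M)
    (hf : f ∈ IsManifold.maximalAtlas (𝓡 (n + 1)) ∞ M) {A : Set M}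
    (hA : MeasurableSet A) (hAe : A ⊆ e.source) (hAf : A ⊆ f.source) :
    S.chartVol e A = S.chartVol f A := by
  have hS : MeasurableSet (f.target ∩ f.symm ⁻¹' A) := by
    have h : Measurable fun v : f.target ↦ f.symm v :=
      (continuousOn_iff_continuous_domRestrict.1 f.continuousOn_symm).measurable
    have h2 := f.open_target.measurableSet.subtype_image (h hA)
    convert h2 using 1
    ext v
    simp [and_comm]
  have himg : e.target ∩ e.symm ⁻¹' A = (e ∘ f.symm) '' (f.target ∩ f.symm ⁻¹' A) := by
    ext u
    constructor
    · rintro ⟨hu, huA⟩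
      refine ⟨f (e.symm u), ⟨f.map_source (hAf huA), ?_⟩, ?_⟩
      · simpa [f.left_inv (hAf huA)] using huA
      · simp [f.left_inv (hAf huA), e.right_inv hu]
    · rintro ⟨v, ⟨hv, hvA⟩, rfl⟩
      refine ⟨e.map_source (hAe hvA), ?_⟩
      simpa [e.left_inv (hAe hvA)] using hvA
  have hinj : InjOn (e ∘ f.symm) (f.target ∩ f.symm ⁻¹' A) := by
    rintro v ⟨hv, hvA⟩ w ⟨hw, hwA⟩ h
    exact f.symm.injOn hv hw (e.injOn (hAe hvA) (hAe hwA) h)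
  have hd : ∀ u ∈ f.target ∩ f.symm ⁻¹' A,
      HasFDerivAt (e ∘ f.symm) (fderiv ℝ (e ∘ f.symm) u) u := by
    rintro u ⟨hu, huA⟩
    have h1 := (contMDiffAt_of_mem_maximalAtlas he (hAe huA)).mdifferentiableAt (by simp)
    have h2 := (contMDiffAt_symm_of_mem_maximalAtlas hf hu).mdifferentiableAt (by simp)
    have h3 := MDifferentiableAt.comp u h1 h2
    exact (mdifferentiableAt_iff_differentiableAt.1 h3).hasFDerivAt
  rw [chartVol_apply S e hA, chartVol_apply S f hA, himg,
    lintegral_image_eq_lintegral_abs_det_fderiv_mul volume hS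
      (fun u hu ↦ (hd u hu).hasFDerivWithinAt) hinj]
  refine setLIntegral_congr_fun hS fun u hu ↦ ?_
  exact (S.density_eq he hu.1 (hAe hu.2) (hd u hu)).symm

/-- In every smooth chart, `vol_g` is given by integration of `√|det g_{ij}|`. -/
theorem vol_apply [BorelSpace M] (S : Spacetime n M)
    {e : OpenPartialHomeomorph M (EuclideanSpace ℝ (Fin (n + 1)))}
    (he : e ∈ IsManifold.maximalAtlas (𝓡 (n + 1)) ∞ M) {A : Set M}
    (hA : MeasurableSet A) (hAe : A ⊆ e.source) :
    S.vol A = ∫⁻ u in e.target ∩ e.symm ⁻¹' A, S.density e u := by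
  rw [← chartVol_apply S e hA]
  have hle : S.vol ≤ S.chartVol e + S.vol.restrict e.sourceᶜ := by
    refine iSup₂_le fun f hf ↦ Measure.le_iff.2 fun B hB ↦ ?_
    have hs := e.open_source.measurableSet
    have h0 : S.chartVol f (B ∩ f.sourceᶜ) = 0 := by
      rw [chartVol_apply S f (hB.inter f.open_source.measurableSet.compl)]
      have : f.target ∩ f.symm ⁻¹' (B ∩ f.sourceᶜ) = ∅ := by
        ext u
        simp only [mem_inter_iff, mem_preimage, mem_compl_iff, mem_empty_iff_false, iff_false]
        rintro ⟨hu, -, h⟩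
        exact h (f.map_target hu)
      rw [this, Measure.restrict_empty, lintegral_zero_measure]
    have h1 : S.chartVol f (B ∩ e.source) ≤ S.chartVol e B := by
      calc S.chartVol f (B ∩ e.source)
          ≤ S.chartVol f (B ∩ e.source ∩ f.source) + S.chartVol f (B ∩ f.sourceᶜ) := by
            refine (measure_mono ?_).trans (measure_union_le _ _)
            intro x hx
            by_cases h : x ∈ f.source
            · exact Or.inl ⟨hx, h⟩
            · exact Or.inr ⟨hx.1, h⟩
        _ = S.chartVol e (B ∩ e.source ∩ f.source) := by
            rw [h0, add_zero]
            exact (S.chartVol_eq he hf ((hB.inter hs).inter f.open_source.measurableSet)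
              (fun x hx ↦ hx.1.2) (fun x hx ↦ hx.2)).symm
        _ ≤ S.chartVol e B := measure_mono fun x hx ↦ hx.1.1
    have h2 : S.chartVol f (B ∩ e.sourceᶜ) ≤ S.vol.restrict e.sourceᶜ B := by
      rw [Measure.restrict_apply hB]
      exact (le_iSup₂ (f := fun e (_ : e ∈ IsManifold.maximalAtlas (𝓡 (n + 1)) ∞ M) ↦
        S.chartVol e) f hf) _
    calc S.chartVol f B = S.chartVol f (B ∩ e.source) + S.chartVol f (B ∩ e.sourceᶜ) := by
          rw [← sdiff_eq, measure_inter_add_sdiff _ hs]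
      _ ≤ _ := by
          rw [Measure.add_apply]
          exact add_le_add h1 h2
  apply le_antisymm
  · refine (hle A).trans ?_
    rw [Measure.add_apply, Measure.restrict_apply hA]
    have : A ∩ e.sourceᶜ = ∅ := by
      rw [← sdiff_eq, sdiff_eq_empty]
      exact hAe
    simp [this]
  · exact (le_iSup₂ (f := fun e (_ : e ∈ IsManifold.maximalAtlas (𝓡 (n + 1)) ∞ M) ↦
      S.chartVol e) e he) _

end Spacetime

end

/-! The engine is a local substitute for limit curve theorems. In a chart, causal curves are moved
by `u ↦ u + f(u) T`, where `T` represents the time orientation at the centre and `f` is a small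
multiple of the exponential of a functional proportional to `g(·, T)`. The change of `f` along a
causal velocity is then proportional to `|f|`, and for a large factor it beats the change of the
metric coefficients, which is also of order `|f|`. So the moved curve is timelike
(`exists_timelike_deformation`, `exists_deformation_family`). As chronological pasts and futures are
open, `I⁺(y) ⊆ I⁺(w)` and `I⁻(w) ⊆ I⁻(y)` hold locally even if `(w, y)` is only a limit of causally
related pairs (`exists_nhds_weaklyPrecedes`). Chaining such steps along a compact interval gives
monotonicity, without regularity.

For past reflection, suppose that `I⁺(y) ⊆ I⁺(x)` but not `I⁻(x) ⊆ I⁻(y)`. Timelike curves from `x`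
to points close to a given point must enter a small neighbourhood of it through the compact
boundary; a limit of the entrance points is a step back into the past (`exists_nhds_escape`).
Repeating this, so that each member of a countable cover of `M \ {x}` is left infinitely often,
yields a descending sequence that cannot converge: not outside `x` by construction, and not to `x`,
since that would give the missing inclusion (`exists_seq_not_tendsto`). Pushed slightly to the
future, it lies on a past-inextendible timelike curve inside `I⁺(x)`, along which `τ ≥ τ(x) > 0`.
This contradicts regularity.

Lower semicontinuity of `τ` always holds, because `I⁻(x)` is exhausted by the pasts of points of
`I⁻(x)` near `x`. For upper semicontinuity, past reflection shows that a common past of points of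
`I⁺(x)` converging to `x` lies in the closure of `I⁻(x)`; the boundary is null
(`vol_closure_chronPast_sdiff`), and finiteness of `τ` gives continuity of the measure from above.
-/

noncomputable section

namespace Spacetime

variable {n : ℕ} {M : Type*} [TopologicalSpace M]
  [ChartedSpace (EuclideanSpace ℝ (Fin (n + 1))) M] [IsManifold (𝓡 (n + 1)) ∞ M]

/-! ### Smooth pieces of curves -/

/-- A predicate on tangent vectors transfers along equalities of base points and of vectors. -/
theorem tangentPred_congr {P : ∀ x : M, TangentSpace (𝓡 (n + 1)) x → Prop} {x y : M}
    {v : TangentSpace (𝓡 (n + 1)) x} {w : TangentSpace (𝓡 (n + 1)) y} (hxy : x = y)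
    (hvw : (v : EuclideanSpace ℝ (Fin (n + 1))) = w) (h : P x v) : P y w := by
  subst hxy
  have : v = w := hvw
  exact this ▸ h

/-- `γ` is smooth on `[a, b]`, where `a < b`, with velocities satisfying `P`. -/
def SmoothPiece (P : ∀ x : M, TangentSpace (𝓡 (n + 1)) x → Prop) (γ : ℝ → M) (a b : ℝ) : Prop :=
  a < b ∧ ContMDiffOn 𝓘(ℝ, ℝ) (𝓡 (n + 1)) ∞ γ (Icc a b) ∧
    ∀ s ∈ Icc a b, P (γ s) (velocity γ a b s)

variable {P Q : ∀ x : M, TangentSpace (𝓡 (n + 1)) x → Prop} {γ σ : ℝ → M} {a b c d : ℝ}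

/-- A nondegenerate interval has unique derivatives, so the one-sided velocities at the new end
points agree with the old ones. -/
theorem SmoothPiece.mono (h : SmoothPiece P γ a b) (hac : a ≤ c) (hcd : c < d) (hdb : d ≤ b) :
    SmoothPiece P γ c d := by
  obtain ⟨hab, hs, hv⟩ := h
  have hsub : Icc c d ⊆ Icc a b := Icc_subset_Icc hac hdb
  refine ⟨hcd, hs.mono hsub, fun s hs' ↦ ?_⟩
  have h1 : MDifferentiableWithinAt 𝓘(ℝ, ℝ) (𝓡 (n + 1)) γ (Icc a b) s :=
    (hs s (hsub hs')).mdifferentiableWithinAt (by simp)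
  have h2 : mfderivWithin 𝓘(ℝ, ℝ) (𝓡 (n + 1)) γ (Icc c d) s
      = mfderivWithin 𝓘(ℝ, ℝ) (𝓡 (n + 1)) γ (Icc a b) s :=
    h1.mfderivWithin_mono (uniqueMDiffWithinAt_iff_uniqueDiffWithinAt.2
      (uniqueDiffOn_Icc hcd s hs')) hsub
  have := hv s (hsub hs')
  rwa [velocity, ← h2] at this

theorem SmoothPiece.congr (h : SmoothPiece P γ a b) (hγ : EqOn σ γ (Icc a b)) :
    SmoothPiece P σ a b := by
  obtain ⟨hab, hs, hv⟩ := h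
  refine ⟨hab, hs.congr hγ, fun s hs' ↦ tangentPred_congr (hγ hs').symm ?_ (hv s hs')⟩
  have : mfderivWithin 𝓘(ℝ, ℝ) (𝓡 (n + 1)) σ (Icc a b) s
      = mfderivWithin 𝓘(ℝ, ℝ) (𝓡 (n + 1)) γ (Icc a b) s := mfderivWithin_congr hγ (hγ hs')
  exact congrArg (fun L : ℝ →L[ℝ] EuclideanSpace ℝ (Fin (n + 1)) ↦ L 1) this.symm

theorem SmoothPiece.imp (h : SmoothPiece P γ a b) (hPQ : ∀ x v, P x v → Q x v) :
    SmoothPiece Q γ a b :=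
  ⟨h.1, h.2.1, fun s hs ↦ hPQ _ _ (h.2.2 s hs)⟩

theorem SmoothPiece.comp_sub (h : SmoothPiece P γ a b) (c : ℝ) :
    SmoothPiece P (fun t ↦ γ (t - c)) (a + c) (b + c) := by
  obtain ⟨hab, hs, hv⟩ := h
  have hmaps : MapsTo (fun t : ℝ ↦ t - c) (Icc (a + c) (b + c)) (Icc a b) :=
    fun t ht ↦ ⟨by linarith [ht.1], by linarith [ht.2]⟩
  have hsm : ContMDiff 𝓘(ℝ, ℝ) 𝓘(ℝ, ℝ) ∞ (fun t : ℝ ↦ t - c) :=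
    (contDiff_id.sub contDiff_const).contMDiff
  refine ⟨by linarith, hs.comp hsm.contMDiffOn hmaps, fun s hs' ↦ ?_⟩
  have hd : HasMFDerivAt 𝓘(ℝ, ℝ) 𝓘(ℝ, ℝ) (fun t : ℝ ↦ t - c) s (ContinuousLinearMap.id ℝ ℝ) :=
    ((hasFDerivAt_id s).sub_const c).hasMFDerivAt
  have h1 : HasMFDerivWithinAt 𝓘(ℝ, ℝ) (𝓡 (n + 1)) γ (Icc a b) (s - c) _ :=
    ((hs _ (hmaps hs')).mdifferentiableWithinAt (by simp)).hasMFDerivWithinAt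
  have h2 := HasMFDerivWithinAt.comp s h1 hd.hasMFDerivWithinAt hmaps
  have h3 := h2.mfderivWithin (uniqueMDiffWithinAt_iff_uniqueDiffWithinAt.2
      (uniqueDiffOn_Icc (by linarith : a + c < b + c) s hs'))
  refine tangentPred_congr rfl ?_ (hv _ (hmaps hs'))
  exact (congrArg (fun L : ℝ →L[ℝ] EuclideanSpace ℝ (Fin (n + 1)) ↦ L 1) h3).symm

/-- Concatenation of pieces is a transitive closure; this replaces indexed subdivisions by induction
on the last piece. -/
theorem piecewiseSmooth_iff_transGen :
    PiecewiseSmooth P γ a b ↔ Relation.TransGen (SmoothPiece P γ) a b := by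
  constructor
  · rintro ⟨hab, k, t, h0, hk, ht⟩
    have key : ∀ j ≤ k, 0 < j → Relation.TransGen (SmoothPiece P γ) (t 0) (t j) := by
      intro j
      induction j with
      | zero => intro _ h; exact absurd h (lt_irrefl 0)
      | succ j ih =>
        intro hj _
        rcases Nat.eq_zero_or_pos j with rfl | hpos
        · exact .single (ht 0 (by omega))
        · exact (ih (by omega) hpos).tail (ht j (by omega))
    have hk0 : 0 < k := by
      rcases Nat.eq_zero_or_pos k with rfl | h
      · exact absurd hab (by rw [← h0, ← hk]; exact lt_irrefl _)
      · exact h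
    have := key k le_rfl hk0
    rwa [h0, hk] at this
  · intro h
    induction h with
    | single h =>
      rename_i b
      refine ⟨h.1, 1, fun i ↦ if i = 0 then a else b, rfl, rfl, fun i hi ↦ ?_⟩
      obtain rfl : i = 0 := by omega
      exact h
    | tail _ h ih =>
      rename_i b c _
      obtain ⟨hab, k, t, h0, hk, ht⟩ := ih
      refine ⟨hab.trans h.1, k + 1, fun i ↦ if i ≤ k then t i else c, by simp [h0], by simp,
        fun i hi ↦ ?_⟩
      rcases Nat.lt_or_ge i k with hik | hik
      · simp only [hik.le, Nat.succ_le_of_lt hik, if_true]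
        exact ht i hik
      · obtain rfl : i = k := by omega
        simp only [le_refl, if_true, Nat.not_succ_le_self, if_false, hk]
        exact h

theorem SmoothPiece.piecewiseSmooth (h : SmoothPiece P γ a b) : PiecewiseSmooth P γ a b :=
  piecewiseSmooth_iff_transGen.2 (.single h)

theorem PiecewiseSmooth.trans (h : PiecewiseSmooth P γ a b) (h' : PiecewiseSmooth P γ b c) :
    PiecewiseSmooth P γ a c :=
  piecewiseSmooth_iff_transGen.2
    ((piecewiseSmooth_iff_transGen.1 h).trans (piecewiseSmooth_iff_transGen.1 h'))

theorem PiecewiseSmooth.induction {R : ℝ → ℝ → Prop} (h : PiecewiseSmooth P γ a b)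
    (single : ∀ {a b}, SmoothPiece P γ a b → R a b)
    (tail : ∀ {a b c}, PiecewiseSmooth P γ a b → SmoothPiece P γ b c → R a b → R a c) :
    R a b := by
  rw [piecewiseSmooth_iff_transGen] at h
  induction h with
  | single h => exact single h
  | tail h h' ih => exact tail (piecewiseSmooth_iff_transGen.2 h) h' ih

theorem PiecewiseSmooth.mono (h : PiecewiseSmooth P γ a b) (hac : a ≤ c) (hcd : c < d)
    (hdb : d ≤ b) : PiecewiseSmooth P γ c d := by
  refine h.induction (R := fun a b ↦ ∀ c d, a ≤ c → c < d → d ≤ b → PiecewiseSmooth P γ c d)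
    (fun h c d hac hcd hdb ↦ (h.mono hac hcd hdb).piecewiseSmooth) ?_ c d hac hcd hdb
  intro a b e h h' ih c d hac hcd hde
  rcases le_or_gt d b with hdb | hbd
  · exact ih c d hac hcd hdb
  · rcases lt_or_ge c b with hcb | hbc
    · exact (ih c b hac hcb le_rfl).trans (h'.mono le_rfl hbd hde).piecewiseSmooth
    · exact (h'.mono hbc hcd hde).piecewiseSmooth

/-- To replace a piecewise smooth curve by another one, it suffices to do so piece by piece. -/
theorem PiecewiseSmooth.map (h : PiecewiseSmooth P γ a b)
    (H : ∀ c d, a ≤ c → d ≤ b → SmoothPiece P γ c d → SmoothPiece Q σ c d) :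
    PiecewiseSmooth Q σ a b := by
  refine h.induction (R := fun a' b' ↦ a' = a → b' ≤ b → PiecewiseSmooth Q σ a' b')
    (fun h ha hb ↦ (H _ _ ha.ge hb h).piecewiseSmooth) ?_ rfl le_rfl
  intro a' b' c' h h' ih ha hc
  exact (ih ha (h'.1.le.trans hc)).trans
    (H _ _ (ha ▸ h.1.le) hc h').piecewiseSmooth

theorem PiecewiseSmooth.congr (h : PiecewiseSmooth P γ a b) (hγ : EqOn σ γ (Icc a b)) :
    PiecewiseSmooth P σ a b :=
  h.map fun _ _ ha hb hs ↦ hs.congr (hγ.mono (Icc_subset_Icc ha hb))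

theorem PiecewiseSmooth.imp (h : PiecewiseSmooth P γ a b) (hPQ : ∀ x v, P x v → Q x v) :
    PiecewiseSmooth Q γ a b :=
  h.map fun _ _ _ _ hs ↦ hs.imp hPQ

theorem PiecewiseSmooth.comp_sub (h : PiecewiseSmooth P γ a b) (c : ℝ) :
    PiecewiseSmooth P (fun t ↦ γ (t - c)) (a + c) (b + c) :=
  h.induction (R := fun a b ↦ PiecewiseSmooth P (fun t ↦ γ (t - c)) (a + c) (b + c))
    (fun h ↦ (h.comp_sub c).piecewiseSmooth)
    (fun _ h' ih ↦ ih.trans (h'.comp_sub c).piecewiseSmooth)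

/-- The last smooth piece of a piecewise smooth curve. -/
theorem PiecewiseSmooth.exists_last (h : PiecewiseSmooth P γ a b) :
    ∃ c, a ≤ c ∧ SmoothPiece P γ c b := by
  refine h.induction (R := fun a b ↦ ∃ c, a ≤ c ∧ SmoothPiece P γ c b) (fun h ↦ ⟨_, le_rfl, h⟩) ?_
  intro a b c h h' _
  exact ⟨b, h.1.le, h'⟩

/-- The first smooth piece of a piecewise smooth curve. -/
theorem PiecewiseSmooth.exists_first (h : PiecewiseSmooth P γ a b) :
    ∃ c, c ≤ b ∧ SmoothPiece P γ a c := by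
  refine h.induction (R := fun a b ↦ ∃ c, c ≤ b ∧ SmoothPiece P γ a c) (fun h ↦ ⟨_, le_rfl, h⟩) ?_
  rintro a b c - h' ⟨d, hd, h⟩
  exact ⟨d, hd.trans h'.1.le, h⟩

/-! ### The chronology relation -/

variable (S : Spacetime n M)

/-- The chronology relation `x ≪ y`. -/
def Chron (x y : M) : Prop :=
  ∃ (γ : ℝ → M) (a b : ℝ), PiecewiseSmooth S.IsFutureTimelike γ a b ∧ γ a = x ∧ γ b = y

variable {S} {x y z : M}

theorem mem_chronFuture : z ∈ S.chronFuture x ↔ S.Chron x z := Iff.rfl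

theorem IsFutureTimelike.isFutureCausal {v : TangentSpace (𝓡 (n + 1)) x}
    (h : S.IsFutureTimelike x v) : S.IsFutureCausal x v := by
  refine ⟨?_, h.1.le, h.2⟩
  rintro rfl
  simpa using h.1

theorem Chron.trans (hxy : S.Chron x y) (hyz : S.Chron y z) : S.Chron x z := by
  obtain ⟨γ, a, b, hγ, rfl, rfl⟩ := hxy
  obtain ⟨σ, c, d, hσ, hc, rfl⟩ := hyz
  have hσ' := hσ.comp_sub (b - c)
  have hcb : c + (b - c) = b := by ring
  rw [hcb] at hσ'
  have hbd := hσ'.1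
  let ρ : ℝ → M := fun t ↦ if t ≤ b then γ t else σ (t - (b - c))
  refine ⟨ρ, a, d + (b - c), (hγ.congr fun t ht ↦ ?_).trans (hσ'.congr fun t ht ↦ ?_), ?_, ?_⟩
  · simp [ρ, ht.2]
  · rcases ht.1.eq_or_lt with rfl | h
    · simp [ρ, hc]
    · simp [ρ, not_le.2 h]
  · simp [ρ, hγ.1.le]
  · simp [ρ, not_le.2 hbd]

/-- A sequence that descends chronologically is joined by a timelike curve without past end
point in the parameter interval. -/
theorem exists_curve_of_chron_seq {q : ℕ → M} (hq : ∀ i, S.Chron (q (i + 1)) (q i)) :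
    ∃ (γ : ℝ → M) (s : ℕ → ℝ), StrictAnti s ∧ (∀ i, γ (s i) = q i) ∧
      ∀ i, PiecewiseSmooth S.IsFutureTimelike γ (s (i + 1)) (s i) := by
  choose σ a b hσ ha hb using hq
  -- The parameter intervals are laid end to end, leftwards from `0`. Their lengths may be summable,
  -- so the break points need not tend to `-∞`; the curve below is then of no interest to the left
  -- of all of them.
  let s : ℕ → ℝ := fun i ↦ - ∑ j ∈ Finset.range i, (b j - a j)
  have hs : ∀ i, s i = s (i + 1) + (b i - a i) := fun i ↦ by
    simp only [s, Finset.sum_range_succ]; ring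
  have hanti : StrictAnti s := strictAnti_nat_of_succ_lt fun i ↦ by
    rw [hs i]; linarith [(hσ i).1]
  classical
  let γ : ℝ → M := fun t ↦ if h : ∃ i, s (i + 1) ≤ t then
    σ (Nat.find h) (t - (s (Nat.find h) - b (Nat.find h))) else q 0
  have hγ : ∀ i, EqOn γ (fun t ↦ σ i (t - (s i - b i))) (Ico (s (i + 1)) (s i)) := by
    intro i t ht
    have h : ∃ i, s (i + 1) ≤ t := ⟨i, ht.1⟩
    have hf : Nat.find h = i := by
      refine (Nat.find_eq_iff h).2 ⟨ht.1, fun j hj hle ↦ ?_⟩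
      exact absurd (ht.2.trans_le (hanti.antitone (Nat.succ_le_of_lt hj))) (not_lt.2 hle)
    simp only [γ, dif_pos h, hf]
  -- the value at the break points does not depend on the piece
  let ρ : ℝ → M := fun t ↦ if 0 ≤ t then q 0 else γ t
  have hval : ∀ i, γ (s (i + 1)) = q (i + 1) := by
    intro i
    rw [hγ i ⟨le_rfl, hanti (Nat.lt_succ_self i)⟩]
    have : s (i + 1) - (s i - b i) = a i := by rw [hs i]; ring
    simp only [this, ha]
  have h0 : s 0 = 0 := by simp [s]
  have hneg : ∀ i, s (i + 1) < 0 := fun i ↦ h0 ▸ hanti (Nat.succ_pos i)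
  have hρs : ∀ i, ρ (s i) = q i := by
    intro i
    cases i with
    | zero => simp [ρ, h0]
    | succ i => simp [ρ, not_le.2 (hneg i), hval]
  refine ⟨ρ, s, hanti, hρs, fun i ↦ ?_⟩
  have h1 := (hσ i).comp_sub (s i - b i)
  have e1 : a i + (s i - b i) = s (i + 1) := by rw [hs i]; ring
  have e2 : b i + (s i - b i) = s i := by ring
  rw [e1, e2] at h1
  refine h1.congr fun t ht ↦ ?_
  rcases ht.2.eq_or_lt with rfl | hlt
  · rw [hρs]
    simp [hb]
  · have : t < 0 := hlt.trans_le (by rw [← h0]; exact hanti.antitone (Nat.zero_le i))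
    simp only [ρ, not_le.2 this, if_false]
    exact hγ i ⟨ht.1, hlt⟩

end Spacetime

namespace Spacetime

variable {n : ℕ} {M : Type*} [TopologicalSpace M]
  [ChartedSpace (EuclideanSpace ℝ (Fin (n + 1))) M] [IsManifold (𝓡 (n + 1)) ∞ M]

/-! ### The metric and the time orientation in a chart -/

section Coordinates

variable (S : Spacetime n M) (e : OpenPartialHomeomorph M (EuclideanSpace ℝ (Fin (n + 1))))

/-- The derivative of the inverse of a chart. -/
def coordFrame (u : EuclideanSpace ℝ (Fin (n + 1))) :
    EuclideanSpace ℝ (Fin (n + 1)) →L[ℝ] EuclideanSpace ℝ (Fin (n + 1)) :=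
  mfderiv (𝓡 (n + 1)) (𝓡 (n + 1)) e.symm u

/-- The metric in the chart `e`. -/
def coordMetric (u : EuclideanSpace ℝ (Fin (n + 1))) :
    EuclideanSpace ℝ (Fin (n + 1)) →L[ℝ] EuclideanSpace ℝ (Fin (n + 1)) →L[ℝ] ℝ :=
  ContinuousLinearMap.bilinearComp (S.metric (e.symm u) : EuclideanSpace ℝ (Fin (n + 1)) →L[ℝ]
    EuclideanSpace ℝ (Fin (n + 1)) →L[ℝ] ℝ) (coordFrame e u) (coordFrame e u)

/-- The inner product with the time orientation in the chart `e`. -/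
def coordTime (u : EuclideanSpace ℝ (Fin (n + 1))) : EuclideanSpace ℝ (Fin (n + 1)) →L[ℝ] ℝ :=
  (ContinuousLinearMap.flip (E := EuclideanSpace ℝ (Fin (n + 1)))
    (F := EuclideanSpace ℝ (Fin (n + 1))) (S.metric (e.symm u))
      (S.timeField (e.symm u))).comp (coordFrame e u)

variable {S e} {u v w : EuclideanSpace ℝ (Fin (n + 1))}

theorem coordMetric_apply :
    S.coordMetric e u v w = S.metric (e.symm u) (coordFrame e u v) (coordFrame e u w) := rfl

theorem coordTime_apply :
    S.coordTime e u v = S.metric (e.symm u) (coordFrame e u v) (S.timeField (e.symm u)) := rfl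

theorem coordMetric_symm : S.coordMetric e u v w = S.coordMetric e u w v :=
  S.metric_symm _ _ _

variable (he : e ∈ IsManifold.maximalAtlas (𝓡 (n + 1)) ∞ M)
include he

theorem hasMFDerivAt_symm (hu : u ∈ e.target) :
    HasMFDerivAt (𝓡 (n + 1)) (𝓡 (n + 1)) e.symm u (coordFrame e u) :=
  ((contMDiffAt_symm_of_mem_maximalAtlas he hu).mdifferentiableAt (by simp)).hasMFDerivAt

/-- The chain rule for `e ∘ e.symm = id` gives a left inverse, which suffices in finite dimension.
-/
theorem coordFrame_bijective (hu : u ∈ e.target) : Function.Bijective (coordFrame e u) := by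
  have h1 : HasMFDerivAt (𝓡 (n + 1)) (𝓡 (n + 1)) e (e.symm u) _ :=
    ((contMDiffAt_of_mem_maximalAtlas he (e.map_target hu)).mdifferentiableAt
      (by simp)).hasMFDerivAt
  have h2 := h1.comp u (hasMFDerivAt_symm he hu)
  have h3 : (e ∘ e.symm) =ᶠ[𝓝 u] id := by
    filter_upwards [e.open_target.mem_nhds hu] with v hv using e.right_inv hv
  have h4 := hasMFDerivAt_unique h2 ((hasMFDerivAt_id u).congr_of_eventuallyEq h3)
  have hinj : Function.Injective (coordFrame e u) := by
    refine Function.LeftInverse.injective (g := mfderiv (𝓡 (n + 1)) (𝓡 (n + 1)) e (e.symm u))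
      fun v ↦ ?_
    exact congrArg (fun L : EuclideanSpace ℝ (Fin (n + 1)) →L[ℝ] EuclideanSpace ℝ (Fin (n + 1)) ↦
      L v) h4
  exact ⟨hinj, LinearMap.surjective_of_injective (f := (coordFrame e u).toLinearMap) hinj⟩

theorem contMDiffOn_coordFrame (v : EuclideanSpace ℝ (Fin (n + 1))) :
    ContMDiffOn (𝓡 (n + 1)) (𝓡 (n + 1)).tangent 1
      (fun u ↦ (⟨e.symm u, coordFrame e u v⟩ : TangentBundle (𝓡 (n + 1)) M)) e.target := by
  have h1 : ContMDiffOn (𝓡 (n + 1)) (𝓡 (n + 1)) 2 e.symm e.target :=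
    (contMDiffOn_symm_of_mem_maximalAtlas he).of_le (by norm_cast)
  have h2 := h1.contMDiffOn_tangentMapWithin (m := 1) (by norm_num)
    e.open_target.uniqueMDiffOn
  have h3 : ContMDiff (𝓡 (n + 1)) (𝓡 (n + 1)).tangent 1
      (fun u ↦ (⟨u, v⟩ : TangentBundle (𝓡 (n + 1)) (EuclideanSpace ℝ (Fin (n + 1))))) :=
    contMDiff_vectorSpace_iff_contDiff.2 contDiff_const
  refine (h2.comp h3.contMDiffOn fun u hu ↦ hu).congr fun u hu ↦ ?_
  simp only [Function.comp, tangentMapWithin, coordFrame]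
  rw [mfderivWithin_of_isOpen e.open_target hu]
  rfl

/-- In finite dimension it suffices to test on fixed vectors. One derivative is enough, since later
only a Lipschitz bound and continuity are needed. -/
theorem contDiffOn_coordMetric : ContDiffOn ℝ 1 (S.coordMetric e) e.target := by
  refine contDiffOn_clm_apply.2 fun v ↦ contDiffOn_clm_apply.2 fun w ↦ ?_
  have hb : ContMDiffOn (𝓡 (n + 1)) (𝓡 (n + 1)) 1 e.symm e.target :=
    (contMDiffOn_symm_of_mem_maximalAtlas he).of_le (by exact_mod_cast le_top)
  have h0 : ContMDiffOn (𝓡 (n + 1)) ((𝓡 (n + 1)).prod 𝓘(ℝ)) 1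
      (fun u ↦ TotalSpace.mk' ℝ (E := Bundle.Trivial M ℝ) (e.symm u)
        (S.metric (e.symm u) (coordFrame e u v) (coordFrame e u w))) e.target := by
    apply ContMDiffOn.clm_bundle_apply₂ (F₁ := EuclideanSpace ℝ (Fin (n + 1)))
      (F₂ := EuclideanSpace ℝ (Fin (n + 1)))
    · exact (S.metric_contMDiff.of_le (by exact_mod_cast le_top)).comp_contMDiffOn hb
    · exact contMDiffOn_coordFrame he v
    · exact contMDiffOn_coordFrame he w
  rw [← contMDiffOn_iff_contDiffOn]
  intro u hu
  have := h0 u hu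
  simp only [contMDiffWithinAt_totalSpace] at this
  exact this.2

theorem continuousOn_coordTime : ContinuousOn (S.coordTime e) e.target := by
  refine continuousOn_clm_apply.2 fun v ↦ ?_
  have h0 : ContinuousOn (fun u ↦ TotalSpace.mk' ℝ (E := Bundle.Trivial M ℝ) (e.symm u)
        (S.metric (e.symm u) (coordFrame e u v) (S.timeField (e.symm u)))) e.target := by
    apply ContinuousOn.clm_bundle_apply₂ (F₁ := EuclideanSpace ℝ (Fin (n + 1)))
      (F₂ := EuclideanSpace ℝ (Fin (n + 1)))
    · exact S.metric_contMDiff.continuous.comp_continuousOn e.continuousOn_symm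
    · exact (contMDiffOn_coordFrame he v).continuousOn
    · exact S.timeField_continuous.comp_continuousOn e.continuousOn_symm
  intro u hu
  have := h0 u hu
  rw [FiberBundle.continuousWithinAt_totalSpace] at this
  exact this.2

/-- The velocity of a curve that is given in a chart. -/
theorem velocity_symm_comp {c : ℝ → EuclideanSpace ℝ (Fin (n + 1))}
    {c' : EuclideanSpace ℝ (Fin (n + 1))} {a b s : ℝ}
    (hab : a < b) (hs : s ∈ Icc a b) (hc : HasDerivWithinAt c c' (Icc a b) s)
    (hu : c s ∈ e.target) :
    velocity (fun t ↦ e.symm (c t)) a b s = coordFrame e (c s) c' := by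
  have h1 := HasMFDerivAt.comp_hasMFDerivWithinAt s (hasMFDerivAt_symm he hu)
    hc.hasFDerivWithinAt.hasMFDerivWithinAt
  have h2 := h1.mfderivWithin (uniqueMDiffWithinAt_iff_uniqueDiffWithinAt.2
    (uniqueDiffOn_Icc hab s hs))
  have h3 := congrArg (fun L : ℝ →L[ℝ] EuclideanSpace ℝ (Fin (n + 1)) ↦ L 1) h2
  refine h3.trans ?_
  change coordFrame e (c s) _ = _
  congr 1
  exact one_smul ℝ c'

theorem smoothPiece_symm_comp {P : ∀ x : M, TangentSpace (𝓡 (n + 1)) x → Prop}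
    {c : ℝ → EuclideanSpace ℝ (Fin (n + 1))} {a b : ℝ} (hab : a < b)
    (hc : ContDiffOn ℝ ∞ c (Icc a b)) (hu : MapsTo c (Icc a b) e.target) :
    SmoothPiece P (fun t ↦ e.symm (c t)) a b ↔
      ∀ s ∈ Icc a b, P (e.symm (c s)) (coordFrame e (c s) (derivWithin c (Icc a b) s)) := by
  have hv : ∀ s ∈ Icc a b, velocity (fun t ↦ e.symm (c t)) a b s =
      coordFrame e (c s) (derivWithin c (Icc a b) s) := fun s hs ↦
    velocity_symm_comp he hab hs
      ((hc s hs).differentiableWithinAt (by simp)).hasDerivWithinAt (hu hs)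
  have hs : ContMDiffOn 𝓘(ℝ, ℝ) (𝓡 (n + 1)) ∞ (fun t ↦ e.symm (c t)) (Icc a b) :=
    (contMDiffOn_symm_of_mem_maximalAtlas he).comp hc.contMDiffOn hu
  constructor
  · rintro ⟨-, -, h⟩ s hs
    exact tangentPred_congr rfl (hv s hs) (h s hs)
  · intro h
    exact ⟨hab, hs, fun s hs ↦ tangentPred_congr rfl (hv s hs).symm (h s hs)⟩

theorem SmoothPiece.coord {P : ∀ x : M, TangentSpace (𝓡 (n + 1)) x → Prop} {γ : ℝ → M} {a b : ℝ}
    (h : SmoothPiece P γ a b) (hγ : MapsTo γ (Icc a b) e.source) :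
    ContDiffOn ℝ ∞ (e ∘ γ) (Icc a b) ∧ ∀ s ∈ Icc a b,
      P (e.symm (e (γ s))) (coordFrame e (e (γ s)) (derivWithin (e ∘ γ) (Icc a b) s)) := by
  have hc : ContDiffOn ℝ ∞ (e ∘ γ) (Icc a b) :=
    contMDiffOn_iff_contDiffOn.1 ((contMDiffOn_of_mem_maximalAtlas he).comp h.2.1 hγ)
  refine ⟨hc, (smoothPiece_symm_comp he h.1 hc fun t ht ↦ e.map_source (hγ ht)).1 ?_⟩
  exact h.congr fun t ht ↦ e.left_inv (hγ ht)

end Coordinates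

/-- A vector orthogonal to a timelike vector is zero or spacelike. -/
theorem metric_pos_of_orthogonal (S : Spacetime n M) {x : M} {T v : TangentSpace (𝓡 (n + 1)) x}
    (hT : S.metric x T T < 0) (hv : S.metric x v v ≤ 0) (hv0 : v ≠ 0) : S.metric x v T ≠ 0 := by
  obtain ⟨b, hb⟩ := S.metric_signature x
  have key : ∀ v w : TangentSpace (𝓡 (n + 1)) x, S.metric x v w =
      - (b.repr v 0 * b.repr w 0) + ∑ i : Fin n, b.repr v i.succ * b.repr w i.succ := by
    intro v w
    conv_lhs => rw [← b.sum_repr v, ← b.sum_repr w]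
    simp only [map_sum, map_smul, _root_.sum_apply, _root_.smul_apply, smul_eq_mul, hb]
    simp [Fin.sum_univ_succ, Fin.succ_ne_zero, mul_comm]
  intro h0
  rw [key] at hT hv h0
  -- By orthogonality, the product of the time components equals the inner product of the spatial
  -- parts. Cauchy–Schwarz is then compatible with the causal character of `v` and `T` only if the
  -- time component of `v`, hence all of `v`, vanishes.
  have hcs := Finset.sum_mul_sq_le_sq_mul_sq Finset.univ (fun i : Fin n ↦ b.repr v i.succ)
    (fun i : Fin n ↦ b.repr T i.succ)
  set v0 := b.repr v 0
  set T0 := b.repr T 0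
  have hA : ∑ i : Fin n, b.repr v i.succ ^ 2 ≤ v0 ^ 2 := by
    simp only [← sq] at hv; linarith
  have hB : ∑ i : Fin n, b.repr T i.succ ^ 2 < T0 ^ 2 := by
    simp only [← sq] at hT; linarith
  have hAB : (v0 * T0) ^ 2 ≤ (∑ i : Fin n, b.repr v i.succ ^ 2) *
      ∑ i : Fin n, b.repr T i.succ ^ 2 := by
    have : v0 * T0 = ∑ i : Fin n, b.repr v i.succ * b.repr T i.succ := by linarith
    rw [this]; exact hcs
  have hA0 : 0 ≤ ∑ i : Fin n, b.repr v i.succ ^ 2 := Finset.sum_nonneg fun i _ ↦ sq_nonneg _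
  have hB0 : 0 ≤ ∑ i : Fin n, b.repr T i.succ ^ 2 := Finset.sum_nonneg fun i _ ↦ sq_nonneg _
  have hv00 : v0 ^ 2 = 0 := by
    by_contra hne
    have : 0 < v0 ^ 2 := lt_of_le_of_ne (sq_nonneg _) (Ne.symm hne)
    nlinarith [mul_le_mul_of_nonneg_right hA hB0, mul_lt_mul_of_pos_left hB this]
  have hz : ∑ i : Fin n, b.repr v i.succ ^ 2 = 0 := le_antisymm (hv00 ▸ hA) hA0
  apply hv0
  refine b.ext_elem fun i ↦ ?_
  rw [map_zero, Finsupp.zero_apply]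
  refine Fin.cases (pow_eq_zero_iff two_ne_zero |>.1 hv00) (fun i ↦ ?_) i
  exact pow_eq_zero_iff two_ne_zero |>.1
    ((Finset.sum_eq_zero_iff_of_nonneg fun i _ ↦ sq_nonneg _).1 hz i (Finset.mem_univ i))

end Spacetime

namespace Spacetime

variable {n : ℕ} {M : Type*} [TopologicalSpace M]
  [ChartedSpace (EuclideanSpace ℝ (Fin (n + 1))) M] [IsManifold (𝓡 (n + 1)) ∞ M]

/-! ### Straight timelike segments and openness of the chronology relation -/

section Local

variable {S : Spacetime n M} {e : OpenPartialHomeomorph M (EuclideanSpace ℝ (Fin (n + 1)))}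

/-- Near a point, the segments whose direction is close to a given future timelike vector are
timelike. -/
theorem exists_chron_of_direction (he : e ∈ IsManifold.maximalAtlas (𝓡 (n + 1)) ∞ M)
    {u₀ v : EuclideanSpace ℝ (Fin (n + 1))} (hu₀ : u₀ ∈ e.target)
    (hv : S.IsFutureTimelike (e.symm u₀) (coordFrame e u₀ v)) :
    ∃ δ > 0, ∀ u ∈ Metric.ball u₀ δ, ∀ u' ∈ Metric.ball u₀ δ, ∀ s : ℝ, 0 < s →
      ‖s⁻¹ • (u' - u) - v‖ < δ → S.Chron (e.symm u) (e.symm u') := by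
  have hG : ContinuousAt (S.coordMetric e) u₀ :=
    (contDiffOn_coordMetric he).continuousOn.continuousAt (e.open_target.mem_nhds hu₀)
  have hα : ContinuousAt (S.coordTime e) u₀ :=
    (continuousOn_coordTime he).continuousAt (e.open_target.mem_nhds hu₀)
  have hfst : ContinuousAt (fun p : EuclideanSpace ℝ (Fin (n + 1)) ×
      EuclideanSpace ℝ (Fin (n + 1)) ↦ p.1) (u₀, v) := continuousAt_fst
  have hsnd : ContinuousAt (fun p : EuclideanSpace ℝ (Fin (n + 1)) ×
      EuclideanSpace ℝ (Fin (n + 1)) ↦ p.2) (u₀, v) := continuousAt_snd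
  -- Being future timelike is an open condition on base point and direction jointly.
  have h1 : ∀ᶠ p : EuclideanSpace ℝ (Fin (n + 1)) × EuclideanSpace ℝ (Fin (n + 1)) in 𝓝 (u₀, v),
      S.coordMetric e p.1 p.2 p.2 < 0 :=
    (((ContinuousAt.comp (x := (u₀, v)) hG hfst).clm_apply hsnd).clm_apply hsnd).eventually_lt
      continuousAt_const hv.1
  have h2 : ∀ᶠ p : EuclideanSpace ℝ (Fin (n + 1)) × EuclideanSpace ℝ (Fin (n + 1)) in 𝓝 (u₀, v),
      S.coordTime e p.1 p.2 < 0 :=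
    ((ContinuousAt.comp (x := (u₀, v)) hα hfst).clm_apply hsnd).eventually_lt
      continuousAt_const hv.2
  have h3 : ∀ᶠ p : EuclideanSpace ℝ (Fin (n + 1)) × EuclideanSpace ℝ (Fin (n + 1)) in 𝓝 (u₀, v),
      p.1 ∈ e.target := hfst (e.open_target.mem_nhds hu₀)
  obtain ⟨δ, hδ, H⟩ := Metric.eventually_nhds_iff_ball.1 (h1.and (h2.and h3))
  refine ⟨δ, hδ, fun u hu u' hu' s hs hd ↦ ?_⟩
  set w := s⁻¹ • (u' - u) with hw
  have H' : ∀ z ∈ Metric.ball u₀ δ, S.coordMetric e z w w < 0 ∧ S.coordTime e z w < 0 ∧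
      z ∈ e.target := fun z hz ↦ H (z, w) <| by
    rw [← ball_prod_same]
    exact ⟨hz, by rwa [Metric.mem_ball, dist_eq_norm]⟩
  let c : ℝ → EuclideanSpace ℝ (Fin (n + 1)) := fun t ↦ u + t • w
  have hcs : c s = u' := by
    simp only [c, hw, smul_smul, mul_inv_cancel₀ hs.ne', one_smul, add_sub_cancel]
  have hc0 : c 0 = u := by simp [c]
  have hcb : MapsTo c (Icc 0 s) (Metric.ball u₀ δ) := by
    intro t ht
    have hseg := (convex_ball u₀ δ).add_smul_sub_mem hu hu'
      (t := t / s) ⟨div_nonneg ht.1 hs.le, (div_le_one hs).2 ht.2⟩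
    have : c t = u + (t / s) • (u' - u) := by
      simp only [c, hw, smul_smul, div_eq_mul_inv]
    rwa [this]
  have hcd : ∀ t, HasDerivAt c w t := fun t ↦ by
    have h := ((hasDerivAt_id t).smul_const w).const_add u
    rw [one_smul] at h
    exact h
  have hcc : ContDiffOn ℝ ∞ c (Icc 0 s) :=
    (contDiff_const.add (contDiff_id.smul contDiff_const)).contDiffOn
  refine ⟨fun t ↦ e.symm (c t), 0, s, ?_, by simp [hc0], by simp [hcs]⟩
  refine ((smoothPiece_symm_comp he hs hcc fun t ht ↦ (H' _ (hcb ht)).2.2).2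
    fun t ht ↦ ?_).piecewiseSmooth
  rw [(hcd t).hasDerivWithinAt.derivWithin (uniqueDiffOn_Icc hs t ht)]
  exact ⟨(H' _ (hcb ht)).1, (H' _ (hcb ht)).2.1⟩

/-- A short final secant in a chart has slope close to the timelike terminal velocity. This persists
when its end point is moved slightly, so the final arc can be replaced by a timelike segment to any
nearby point. -/
theorem isOpen_chronFuture (S : Spacetime n M) (x : M) : IsOpen (S.chronFuture x) := by
  refine isOpen_iff_mem_nhds.2 ?_
  rintro y ⟨γ, a, b, hγ, rfl, rfl⟩
  obtain ⟨c, hac, hc⟩ := hγ.exists_last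
  let e := chartAt (EuclideanSpace ℝ (Fin (n + 1))) (γ b)
  have he : e ∈ IsManifold.maximalAtlas (𝓡 (n + 1)) ∞ M :=
    IsManifold.chart_mem_maximalAtlas _
  have hb : γ b ∈ e.source := mem_chart_source _ _
  have hcont := hc.2.1.continuousOn b ⟨hc.1.le, le_rfl⟩
  obtain ⟨c', hc', hmaps⟩ : ∃ c' ∈ Ico c b, MapsTo γ (Icc c' b) e.source := by
    have h := hcont (e.open_source.mem_nhds hb)
    rw [mem_map, nhdsWithin_Icc_eq_nhdsLE hc.1, mem_nhdsLE_iff_exists_Icc_subset] at h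
    obtain ⟨l, hl, hsub⟩ := h
    exact ⟨max c l, ⟨le_max_left _ _, max_lt hc.1 hl⟩,
      (Icc_subset_Icc_left (le_max_right _ _)).trans hsub⟩
  have hp := hc.mono hc'.1 hc'.2 le_rfl
  obtain ⟨hsm, hP⟩ := hp.coord he hmaps
  have hbI : b ∈ Icc c' b := ⟨hc'.2.le, le_rfl⟩
  have hder := ((hsm b hbI).differentiableWithinAt (by simp)).hasDerivWithinAt
  have hv := hP b hbI
  set v := derivWithin (e ∘ γ) (Icc c' b) b
  obtain ⟨δ, hδ, H⟩ := exists_chron_of_direction he (e.map_source hb) hv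
  have hslope := hasDerivWithinAt_iff_tendsto_slope.1 hder
  have hne : Icc c' b \ {b} = Ico c' b := Icc_sdiff_right
  rw [hne] at hslope
  have h1 : ∀ᶠ s in 𝓝[Ico c' b] b, slope (e ∘ γ) b s ∈ Metric.ball v δ :=
    hslope (Metric.ball_mem_nhds _ hδ)
  have h2 : ∀ᶠ s in 𝓝[Ico c' b] b, (e ∘ γ) s ∈ Metric.ball (e (γ b)) δ :=
    ((hsm.continuousOn b hbI).mono Ico_subset_Icc_self) (Metric.ball_mem_nhds _ hδ)
  have h3 : ∀ᶠ s in 𝓝[Ico c' b] b, s ∈ Ioo c' b := by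
    filter_upwards [self_mem_nhdsWithin, mem_nhdsWithin_of_mem_nhds (Ioi_mem_nhds hc'.2)]
      with s hs hs' using ⟨hs', hs.2⟩
  have : (𝓝[Ico c' b] b).NeBot := by
    rw [nhdsWithin_Ico_eq_nhdsLT hc'.2]; infer_instance
  obtain ⟨s, hs1, hs2, hs3⟩ := (h1.and (h2.and h3)).exists
  have hec : ContinuousAt e (γ b) := e.continuousAt hb
  have h4 : ∀ᶠ z in 𝓝 (γ b), e z ∈ Metric.ball (e (γ b)) δ := hec (Metric.ball_mem_nhds _ hδ)
  have h5 : ∀ᶠ z in 𝓝 (γ b), ‖(b - s)⁻¹ • (e z - e (γ s)) - v‖ < δ := by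
    refine ContinuousAt.eventually_lt (by fun_prop) continuousAt_const ?_
    rw [Metric.mem_ball, dist_eq_norm, slope_comm, slope_def_module] at hs1
    exact hs1
  have h6 : ∀ᶠ z in 𝓝 (γ b), z ∈ e.source := e.open_source.mem_nhds hb
  filter_upwards [h4, h5, h6] with z hz4 hz5 hz6
  have hzc := H (e (γ s)) hs2 (e z) hz4 (b - s) (by linarith [hs3.2]) hz5
  rw [e.left_inv hz6, e.left_inv (hmaps ⟨hs3.1.le, hs3.2.le⟩)] at hzc
  have hxs : S.Chron (γ a) (γ s) :=
    ⟨γ, a, s, hγ.mono le_rfl (hac.trans_lt (hc'.1.trans_lt hs3.1)) hs3.2.le, rfl, rfl⟩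
  exact hxs.trans hzc

/-- The mirror image, with an initial secant and the initial velocity. -/
theorem isOpen_chronPast (S : Spacetime n M) (x : M) : IsOpen (S.chronPast x) := by
  refine isOpen_iff_mem_nhds.2 ?_
  rintro y ⟨γ, a, b, hγ, rfl, rfl⟩
  obtain ⟨c, hcb, hc⟩ := hγ.exists_first
  let e := chartAt (EuclideanSpace ℝ (Fin (n + 1))) (γ a)
  have he : e ∈ IsManifold.maximalAtlas (𝓡 (n + 1)) ∞ M :=
    IsManifold.chart_mem_maximalAtlas _
  have ha : γ a ∈ e.source := mem_chart_source _ _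
  have hcont := hc.2.1.continuousOn a ⟨le_rfl, hc.1.le⟩
  obtain ⟨c', hc', hmaps⟩ : ∃ c' ∈ Ioc a c, MapsTo γ (Icc a c') e.source := by
    have h := hcont (e.open_source.mem_nhds ha)
    rw [mem_map, nhdsWithin_Icc_eq_nhdsGE hc.1, mem_nhdsGE_iff_exists_Icc_subset] at h
    obtain ⟨l, hl, hsub⟩ := h
    exact ⟨min c l, ⟨lt_min hc.1 hl, min_le_left _ _⟩,
      (Icc_subset_Icc_right (min_le_right _ _)).trans hsub⟩
  have hp := hc.mono le_rfl hc'.1 hc'.2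
  obtain ⟨hsm, hP⟩ := hp.coord he hmaps
  have haI : a ∈ Icc a c' := ⟨le_rfl, hc'.1.le⟩
  have hder := ((hsm a haI).differentiableWithinAt (by simp)).hasDerivWithinAt
  have hv := hP a haI
  set v := derivWithin (e ∘ γ) (Icc a c') a
  obtain ⟨δ, hδ, H⟩ := exists_chron_of_direction he (e.map_source ha) hv
  have hslope := hasDerivWithinAt_iff_tendsto_slope.1 hder
  have hne : Icc a c' \ {a} = Ioc a c' := Icc_sdiff_left
  rw [hne] at hslope
  have h1 : ∀ᶠ s in 𝓝[Ioc a c'] a, slope (e ∘ γ) a s ∈ Metric.ball v δ :=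
    hslope (Metric.ball_mem_nhds _ hδ)
  have h2 : ∀ᶠ s in 𝓝[Ioc a c'] a, (e ∘ γ) s ∈ Metric.ball (e (γ a)) δ :=
    ((hsm.continuousOn a haI).mono Ioc_subset_Icc_self) (Metric.ball_mem_nhds _ hδ)
  have h3 : ∀ᶠ s in 𝓝[Ioc a c'] a, s ∈ Ioo a c' := by
    filter_upwards [self_mem_nhdsWithin, mem_nhdsWithin_of_mem_nhds (Iio_mem_nhds hc'.1)]
      with s hs hs' using ⟨hs.1, hs'⟩
  have : (𝓝[Ioc a c'] a).NeBot := by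
    rw [nhdsWithin_Ioc_eq_nhdsGT hc'.1]; infer_instance
  obtain ⟨s, hs1, hs2, hs3⟩ := (h1.and (h2.and h3)).exists
  have hec : ContinuousAt e (γ a) := e.continuousAt ha
  have h4 : ∀ᶠ z in 𝓝 (γ a), e z ∈ Metric.ball (e (γ a)) δ := hec (Metric.ball_mem_nhds _ hδ)
  have h5 : ∀ᶠ z in 𝓝 (γ a), ‖(s - a)⁻¹ • (e (γ s) - e z) - v‖ < δ := by
    refine ContinuousAt.eventually_lt (by fun_prop) continuousAt_const ?_
    rw [Metric.mem_ball, dist_eq_norm, slope_def_module] at hs1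
    exact hs1
  have h6 : ∀ᶠ z in 𝓝 (γ a), z ∈ e.source := e.open_source.mem_nhds ha
  filter_upwards [h4, h5, h6] with z hz4 hz5 hz6
  have hzc := H (e z) hz4 (e (γ s)) hs2 (s - a) (by linarith [hs3.1]) hz5
  rw [e.left_inv hz6, e.left_inv (hmaps ⟨hs3.1.le, hs3.2.le⟩)] at hzc
  have hxs : S.Chron (γ s) (γ b) :=
    ⟨γ, s, b, hγ.mono hs3.1.le (hs3.2.trans_le (hc'.2.trans hcb)) le_rfl, rfl, rfl⟩
  exact hzc.trans hxs

theorem isFutureTimelike_timeField (S : Spacetime n M) (x : M) :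
    S.IsFutureTimelike x (S.timeField x) :=
  ⟨S.timeField_timelike x, S.timeField_timelike x⟩

/-- A vector that represents the time orientation at a point of a chart. -/
theorem exists_coordFrame_eq_timeField (S : Spacetime n M)
    (he : e ∈ IsManifold.maximalAtlas (𝓡 (n + 1)) ∞ M)
    {u₀ : EuclideanSpace ℝ (Fin (n + 1))} (hu₀ : u₀ ∈ e.target) :
    ∃ T, coordFrame e u₀ T = S.timeField (e.symm u₀) :=
  (coordFrame_bijective he hu₀).2 _

/-- Around every point of a chart there is a ball in which the lines in a certain direction are
timelike. -/
theorem exists_chron_of_sub_eq_smul (S : Spacetime n M)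
    (he : e ∈ IsManifold.maximalAtlas (𝓡 (n + 1)) ∞ M)
    {u₀ : EuclideanSpace ℝ (Fin (n + 1))} (hu₀ : u₀ ∈ e.target) :
    ∃ T, coordFrame e u₀ T = S.timeField (e.symm u₀) ∧ ∃ δ > 0, ∀ u ∈ Metric.ball u₀ δ, ∀ s : ℝ,
      0 < s → u + s • T ∈ Metric.ball u₀ δ → S.Chron (e.symm u) (e.symm (u + s • T)) := by
  obtain ⟨T, hT⟩ := S.exists_coordFrame_eq_timeField he hu₀
  obtain ⟨δ, hδ, H⟩ := exists_chron_of_direction (S := S) he hu₀ (v := T)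
    (hT ▸ S.isFutureTimelike_timeField _)
  refine ⟨T, hT, δ, hδ, fun u hu s hs hu' ↦ H u hu _ hu' s hs ?_⟩
  simpa [smul_smul, inv_mul_cancel₀ hs.ne'] using hδ

/-- The coordinate line through `x` in the direction of the time orientation provides the
approximating points. -/
theorem mem_closure_chron (S : Spacetime n M) (x : M) :
    x ∈ closure (S.chronFuture x) ∧ x ∈ closure (S.chronPast x) := by
  let e := chartAt (EuclideanSpace ℝ (Fin (n + 1))) x
  have he : e ∈ IsManifold.maximalAtlas (𝓡 (n + 1)) ∞ M :=
    IsManifold.chart_mem_maximalAtlas _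
  have hx : x ∈ e.source := mem_chart_source _ _
  obtain ⟨T, -, δ, hδ, H⟩ := S.exists_chron_of_sub_eq_smul he (e.map_source hx)
  have hx0 : e x ∈ Metric.ball (e x) δ := Metric.mem_ball_self hδ
  have hc : Tendsto (fun s : ℝ ↦ e x + s • T) (𝓝 0) (𝓝 (e x)) := by
    have : Continuous fun s : ℝ ↦ e x + s • T := by fun_prop
    simpa using this.tendsto 0
  have hc' : Tendsto (fun s : ℝ ↦ e.symm (e x + s • T)) (𝓝 0) (𝓝 x) := by
    have := (e.continuousAt_symm (e.map_source hx)).tendsto.comp hc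
    rwa [e.left_inv hx] at this
  have hball : ∀ᶠ s in 𝓝 (0 : ℝ), e x + s • T ∈ Metric.ball (e x) δ :=
    hc (Metric.ball_mem_nhds _ hδ)
  constructor
  · refine mem_closure_of_tendsto (hc'.mono_left (nhdsWithin_le_nhds (s := Ioi 0))) ?_
    filter_upwards [self_mem_nhdsWithin, mem_nhdsWithin_of_mem_nhds hball] with s hs hs'
    have := H _ hx0 s hs hs'
    rwa [e.left_inv hx] at this
  · refine mem_closure_of_tendsto (hc'.mono_left (nhdsWithin_le_nhds (s := Iio 0))) ?_
    filter_upwards [self_mem_nhdsWithin, mem_nhdsWithin_of_mem_nhds hball] with s hs hs'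
    have := H _ hs' (-s) (neg_pos.2 hs) (by simpa using hx0)
    rw [neg_smul, add_neg_cancel_right, e.left_inv hx] at this
    exact this

end Local

end Spacetime

/-! ### Pointwise estimates for the deformation of causal vectors -/

namespace Spacetime

set_option synthInstance.maxHeartbeats 400000 in
/-- A family of bilinear forms of class `C¹` is locally Lipschitz, uniformly on bounded vectors. -/
theorem exists_lipschitz_bilinear {E : Type*} [NormedAddCommGroup E] [NormedSpace ℝ E]
    {G : E → E →L[ℝ] E →L[ℝ] ℝ} {u₀ : E} (hG : ContDiffAt ℝ 1 G u₀) :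
    ∃ K : ℝ, 0 ≤ K ∧ ∃ V ∈ 𝓝 u₀, ∀ u ∈ V, ∀ u' ∈ V, ∀ v w,
      |G u' v w - G u v w| ≤ K * ‖u' - u‖ * ‖v‖ * ‖w‖ := by
  obtain ⟨K, V, hV, hLip⟩ := hG.exists_lipschitzOnWith
  refine ⟨K, K.2, V, hV, fun u hu u' hu' v w ↦ ?_⟩
  have h1 := hLip.dist_le_mul u' hu' u hu
  rw [dist_eq_norm, dist_eq_norm] at h1
  have h2 := (G u' - G u).le_opNorm₂ v w
  refine h2.trans ?_
  gcongr

/-- A pointwise estimate: if `v` is causal at `u`, then at `u + f T` the vector `v + k |f| ℓ(v) T`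
is timelike, for large `k`. -/
theorem exists_timelike_deformation {E : Type*} [NormedAddCommGroup E] [NormedSpace ℝ E]
    [FiniteDimensional ℝ E] {G : E → E →L[ℝ] E →L[ℝ] ℝ} {α : E → E →L[ℝ] ℝ} {u₀ T : E}
    (hG : ContDiffAt ℝ 1 G u₀) (hα : ContinuousAt α u₀) (hT : G u₀ T T < 0)
    (hαT : ∀ v, α u₀ v = G u₀ v T) (hsymm : ∀ u v w, G u v w = G u w v)
    (hort : ∀ v, v ≠ 0 → G u₀ v v ≤ 0 → G u₀ v T ≠ 0) :
    ∃ k : ℝ, ∃ V ∈ 𝓝 u₀, ∀ u v (f : ℝ), u ∈ V → u + f • T ∈ V → f ≠ 0 → v ≠ 0 →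
      G u v v ≤ 0 → α u v < 0 →
      G (u + f • T) (v + (k * |f| * (-G u₀ v T)) • T) (v + (k * |f| * (-G u₀ v T)) • T) < 0 ∧
      α (u + f • T) (v + (k * |f| * (-G u₀ v T)) • T) < 0 := by
  -- Quantitative form of `hort`: a unit vector is either spacelike by at least `m`, or its product
  -- with `T` has absolute value at least `m`.
  obtain ⟨m, hm, hmin⟩ := (isCompact_sphere (0 : E) 1).exists_forall_le'
    (f := fun v ↦ max (G u₀ v v) |G u₀ v T|)
    ((((G u₀).continuous.clm_apply continuous_id).max
      ((G u₀).continuous.clm_apply continuous_const).abs).continuousOn) (a := 0) (by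
      intro v hv
      have hv0 : v ≠ 0 := by
        rintro rfl
        simp at hv
      rcases le_or_gt (G u₀ v v) 0 with h | h
      · exact lt_max_of_lt_right (abs_pos.2 (hort v hv0 h))
      · exact lt_max_of_lt_left h)
  obtain ⟨K, hK, V₀, hV₀, hLip⟩ := exists_lipschitz_bilinear hG
  have hT0 : 0 ≤ ‖T‖ := norm_nonneg T
  -- a neighbourhood in which everything is almost constant
  have h1 : ∀ᶠ u in 𝓝 u₀, K * ‖u - u₀‖ < m := by
    refine ContinuousAt.eventually_lt (by fun_prop) continuousAt_const (by simpa using hm)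
  have h2 : ∀ᶠ u in 𝓝 u₀, K * ‖u - u₀‖ * ‖T‖ < m / 2 := by
    refine ContinuousAt.eventually_lt (by fun_prop) continuousAt_const (by simpa using hm)
  have h3 : ∀ᶠ u in 𝓝 u₀, ‖α u - α u₀‖ < m := by
    refine ContinuousAt.eventually_lt (by fun_prop) continuousAt_const (by simpa using hm)
  have h4 : ∀ᶠ u in 𝓝 u₀, G u T T < 0 :=
    ((hG.continuousAt.clm_apply continuousAt_const).clm_apply continuousAt_const).eventually_lt
      continuousAt_const hT
  have h5 : ∀ᶠ u in 𝓝 u₀, α u T < 0 :=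
    (hα.clm_apply continuousAt_const).eventually_lt continuousAt_const (by rw [hαT]; exact hT)
  -- Moving the base point by `f T` changes `G v v` by at most `K |f| ‖T‖ ‖v‖²`, while the cross
  -- term of the correction is at most `-k |f| m² ‖v‖²`. The first summand of `k` balances the two,
  -- and `+ 1` makes the result strictly negative.
  refine ⟨K * ‖T‖ / m ^ 2 + 1, _, (h1.and (h2.and (h3.and (h4.and (h5.and hV₀))))), ?_⟩
  rintro u v f ⟨hu1, -, hu3, -, -, huV⟩ ⟨-, hu2', hu3', hu4', hu5', huV'⟩ hf hv hGv hαv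
  set u' := u + f • T with hu'
  set l := -G u₀ v T with hl
  set k := K * ‖T‖ / m ^ 2 + 1 with hk
  have hn : 0 < ‖v‖ := norm_pos_iff.2 hv
  have hu₀ : u₀ ∈ V₀ := mem_of_mem_nhds hV₀
  -- causal vectors have large `ℓ`
  have hlabs : m * ‖v‖ ≤ |l| := by
    have hv1 : ‖v‖⁻¹ • v ∈ Metric.sphere (0 : E) 1 := by
      simp [norm_smul, hn.ne']
    have h := hmin _ hv1
    have hlt : G u₀ (‖v‖⁻¹ • v) (‖v‖⁻¹ • v) < m := by
      have a1 := (abs_le.1 (hLip u₀ hu₀ u huV v v)).1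
      have a2 : K * ‖u - u₀‖ * ‖v‖ * ‖v‖ < m * ‖v‖ * ‖v‖ := by gcongr
      have a3 : G u₀ v v < m * ‖v‖ * ‖v‖ := by linarith
      simp only [map_smul, _root_.smul_apply, smul_eq_mul]
      rw [inv_mul_lt_iff₀ hn, inv_mul_lt_iff₀ hn]
      linarith
    have h' : m ≤ |G u₀ (‖v‖⁻¹ • v) T| := (le_max_iff.1 h).resolve_left (not_le.2 hlt)
    simp only [map_smul, _root_.smul_apply, smul_eq_mul, abs_mul, abs_inv, abs_norm] at h'
    rw [le_inv_mul_iff₀ hn] at h'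
    rw [hl, abs_neg]
    linarith
  have hopα : ∀ w, ‖α w - α u₀‖ < m → |α w v - α u₀ v| < m * ‖v‖ := by
    intro w hw
    refine lt_of_le_of_lt ?_ (mul_lt_mul_of_pos_right hw hn)
    simpa using (α w - α u₀).le_opNorm v
  -- The time orientation fixes the sign of `l`: as `α` varies by less than `m`, the value `l ≤ -m
  -- ‖v‖` would contradict `α u v < 0`.
  have hlpos : m * ‖v‖ ≤ l := by
    have a1 := (abs_lt.1 (hopα u hu3)).1
    have a2 : α u₀ v = -l := by rw [hαT, hl, neg_neg]
    rcases le_abs.1 hlabs with h | h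
    · exact h
    · linarith
  have hl0 : 0 < l := (mul_pos hm hn).trans_le hlpos
  have hf0 : 0 < |f| := abs_pos.2 hf
  have hk0 : 0 < k := by positivity
  constructor
  · have b1 : G u' v v ≤ K * (|f| * ‖T‖) * ‖v‖ * ‖v‖ := by
      have a1 := (abs_le.1 (hLip u huV u' huV' v v)).2
      rw [hu', add_sub_cancel_left, norm_smul, Real.norm_eq_abs] at a1
      linarith
    have b2 : G u' v T ≤ -l / 2 := by
      have a1 := (abs_le.1 (hLip u₀ hu₀ u' huV' v T)).2
      have a2 : K * ‖u' - u₀‖ * ‖v‖ * ‖T‖ ≤ m / 2 * ‖v‖ := by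
        have := mul_le_mul_of_nonneg_right hu2'.le hn.le
        linarith
      have a3 : G u₀ v T = -l := by rw [hl, neg_neg]
      linarith
    have b3 : G u' (v + (k * |f| * l) • T) (v + (k * |f| * l) • T) =
        G u' v v + 2 * (k * |f| * l) * G u' v T + (k * |f| * l) ^ 2 * G u' T T := by
      simp only [map_add, map_smul, _root_.add_apply, _root_.smul_apply, smul_eq_mul,
        hsymm u' T v]
      ring
    have b4 : 2 * (k * |f| * l) * G u' v T ≤ -(k * |f| * l ^ 2) := by
      have := mul_le_mul_of_nonneg_left b2 (by positivity : 0 ≤ 2 * (k * |f| * l))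
      nlinarith
    have b5 : (k * |f| * l ^ 2) ≥ k * |f| * (m * ‖v‖) ^ 2 := by
      have : (m * ‖v‖) ^ 2 ≤ l ^ 2 := pow_le_pow_left₀ (by positivity) hlpos 2
      exact mul_le_mul_of_nonneg_left this (by positivity)
    have b6 : k * |f| * (m * ‖v‖) ^ 2 =
        K * (|f| * ‖T‖) * ‖v‖ * ‖v‖ + |f| * (m * ‖v‖) ^ 2 := by
      rw [hk]
      field_simp
    have b7 : (k * |f| * l) ^ 2 * G u' T T ≤ 0 :=
      mul_nonpos_of_nonneg_of_nonpos (sq_nonneg _) hu4'.le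
    have b8 : 0 < |f| * (m * ‖v‖) ^ 2 := by positivity
    rw [b3]
    linarith
  · have c1 := (abs_lt.1 (hopα u' hu3')).2
    have c2 : α u₀ v = -l := by rw [hαT, hl, neg_neg]
    have c3 : k * |f| * l * α u' T < 0 := mul_neg_of_pos_of_neg (by positivity) hu5'
    simp only [map_add, map_smul, smul_eq_mul]
    linarith

end Spacetime

/-! ### Deformation of causal curves into timelike ones -/

namespace Spacetime

variable {n : ℕ} {M : Type*} [TopologicalSpace M]
  [ChartedSpace (EuclideanSpace ℝ (Fin (n + 1))) M] [IsManifold (𝓡 (n + 1)) ∞ M]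

/-- Every point has a neighbourhood with small deformations, towards the future (`η = 1`) and
towards the past (`η = -1`), that make causal curves timelike. -/
theorem exists_deformation_family (S : Spacetime n M) (x₀ : M) :
    ∃ N : Set M, IsOpen N ∧ x₀ ∈ N ∧ ∀ η : ℝ, (η = 1 ∨ η = -1) → ∃ Ψ : ℝ → M → M,
      (∀ y ∈ N, Tendsto (fun s ↦ Ψ s y) (𝓝[>] 0) (𝓝 y)) ∧
      ∀ᶠ s in 𝓝[>] (0 : ℝ), ContinuousOn (Ψ s) N ∧
        (∀ (σ : ℝ → M) (a b : ℝ), PiecewiseSmooth S.IsFutureCausal σ a b →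
          MapsTo σ (Icc a b) N → PiecewiseSmooth S.IsFutureTimelike (Ψ s ∘ σ) a b) ∧
        ∀ w ∈ N, (η = 1 → S.Chron w (Ψ s w)) ∧ (η = -1 → S.Chron (Ψ s w) w) := by
  let e := chartAt (EuclideanSpace ℝ (Fin (n + 1))) x₀
  have he : e ∈ IsManifold.maximalAtlas (𝓡 (n + 1)) ∞ M :=
    IsManifold.chart_mem_maximalAtlas _
  have hx₀ : x₀ ∈ e.source := mem_chart_source _ _
  have hu₀ : e x₀ ∈ e.target := e.map_source hx₀
  set u₀ := e x₀ with hu₀_def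
  obtain ⟨T, hT, δ, hδ, hseg⟩ := S.exists_chron_of_sub_eq_smul he hu₀
  have hαT : ∀ v, S.coordTime e u₀ v = S.coordMetric e u₀ v T := fun v ↦ by
    rw [coordTime_apply, coordMetric_apply, hT]
  have hTT : S.coordMetric e u₀ T T < 0 := by
    rw [coordMetric_apply, hT]
    exact S.timeField_timelike _
  have hort : ∀ v, v ≠ 0 → S.coordMetric e u₀ v v ≤ 0 → S.coordMetric e u₀ v T ≠ 0 := by
    intro v hv hvv
    refine S.metric_pos_of_orthogonal hTT hvv fun h ↦ hv ?_
    exact (coordFrame_bijective he hu₀).1 (h.trans (map_zero _).symm)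
  obtain ⟨k, V, hV, hdef⟩ := exists_timelike_deformation
    ((contDiffOn_coordMetric (S := S) he).contDiffAt (e.open_target.mem_nhds hu₀))
    ((continuousOn_coordTime he).continuousAt (e.open_target.mem_nhds hu₀))
    hTT hαT (fun u v w ↦ coordMetric_symm) hort
  simp only [← hαT] at hdef
  set ℓ : EuclideanSpace ℝ (Fin (n + 1)) →L[ℝ] ℝ := -S.coordTime e u₀ with hℓ
  obtain ⟨r, hr, hball⟩ := Metric.mem_nhds_iff.1
    (inter_mem hV (inter_mem (e.open_target.mem_nhds hu₀) (Metric.ball_mem_nhds u₀ hδ)))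
  have hN : ∀ x, x ∈ e.source ∩ e ⁻¹' Metric.ball u₀ (r / 2) → e x ∈ Metric.ball u₀ r :=
    fun x hx ↦ Metric.ball_subset_ball (by linarith) hx.2
  refine ⟨e.source ∩ e ⁻¹' Metric.ball u₀ (r / 2),
    e.isOpen_inter_preimage Metric.isOpen_ball,
    ⟨hx₀, Metric.mem_ball_self (by linarith)⟩, fun η hη ↦ ?_⟩
  have hη1 : |η| = 1 := by rcases hη with rfl | rfl <;> simp
  have hη2 : η * η = 1 := by rcases hη with rfl | rfl <;> simp
  -- The exponential solves `df = k |f| ℓ`, which is the correction required by the pointwise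
  -- estimate. The second `η`, in the exponent, keeps the sign of this derivative the same for
  -- displacements to the past.
  let f : ℝ → EuclideanSpace ℝ (Fin (n + 1)) → ℝ := fun s u ↦ η * (s * Real.exp (k * η * ℓ u))
  have hfabs : ∀ s u, 0 < s → |f s u| = s * Real.exp (k * η * ℓ u) := fun s u hs ↦ by
    simp only [f, abs_mul, hη1, one_mul, abs_of_pos hs, Real.abs_exp]
  refine ⟨fun s x ↦ e.symm (e x + f s (e x) • T), fun y hy ↦ ?_, ?_⟩
  · have hc : Continuous fun s ↦ e y + f s (e y) • T := by fun_prop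
    have h0 : e y + f 0 (e y) • T = e y := by simp [f]
    have h1 : Tendsto (fun s ↦ e y + f s (e y) • T) (𝓝[>] 0) (𝓝 (e y)) := by
      have := hc.tendsto 0
      rw [h0] at this
      exact this.mono_left nhdsWithin_le_nhds
    have h2 := (e.continuousAt_symm (e.map_source hy.1)).tendsto.comp h1
    rwa [e.left_inv hy.1] at h2
  -- A bound for `|ℓ|` on the ball, which makes the displacement uniformly small in `s`.
  let B := ‖ℓ‖ * (‖u₀‖ + r)
  have hsmall : ∀ᶠ s in 𝓝[>] (0 : ℝ), s * Real.exp (|k| * B) * ‖T‖ < r / 2 := by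
    refine mem_nhdsWithin_of_mem_nhds (ContinuousAt.eventually_lt (by fun_prop)
      continuousAt_const (by simpa using hr))
  filter_upwards [hsmall, self_mem_nhdsWithin] with s hs hs0
  have hs0 : 0 < s := hs0
  have hΦ : ∀ u ∈ Metric.ball u₀ (r / 2), u + f s u • T ∈ Metric.ball u₀ r := by
    intro u hu
    have hun : ‖u‖ ≤ ‖u₀‖ + r := by
      rw [Metric.mem_ball, dist_eq_norm] at hu
      have := norm_sub_norm_le u u₀
      linarith
    have hle : |f s u| ≤ s * Real.exp (|k| * B) := by
      rw [hfabs s u hs0]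
      refine mul_le_mul_of_nonneg_left (Real.exp_le_exp.2 ?_) hs0.le
      calc k * η * ℓ u ≤ |k * η * ℓ u| := le_abs_self _
        _ = |k| * |ℓ u| := by rw [abs_mul, abs_mul, hη1, mul_one]
        _ ≤ |k| * B := by
          refine mul_le_mul_of_nonneg_left ?_ (abs_nonneg _)
          exact (ℓ.le_opNorm u).trans (mul_le_mul_of_nonneg_left hun (norm_nonneg _))
    rw [Metric.mem_ball, dist_eq_norm] at hu ⊢
    have h1 : ‖f s u • T‖ < r / 2 := by
      rw [norm_smul, Real.norm_eq_abs]
      exact (mul_le_mul_of_nonneg_right hle (norm_nonneg _)).trans_lt hs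
    calc ‖u + f s u • T - u₀‖ = ‖(u - u₀) + f s u • T‖ := by congr 1; abel
      _ ≤ ‖u - u₀‖ + ‖f s u • T‖ := norm_add_le _ _
      _ < r := by linarith
  have hf0 : ∀ u, f s u ≠ 0 := fun u ↦ abs_pos.1 (by rw [hfabs s u hs0]; positivity)
  refine ⟨?_, ?_, ?_⟩
  · refine e.continuousOn_symm.comp (t := e.target) ?_ fun x hx ↦ (hball (hΦ _ hx.2)).2.1
    have hec : ContinuousOn e (e.source ∩ e ⁻¹' Metric.ball u₀ (r / 2)) :=
      e.continuousOn.mono inter_subset_left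
    have hfc : Continuous fun u ↦ u + f s u • T := by fun_prop
    exact hfc.comp_continuousOn hec
  · intro σ a b hσ hmaps
    refine hσ.map fun c d hac hdb hp ↦ ?_
    have hmaps' : MapsTo σ (Icc c d) (e.source ∩ e ⁻¹' Metric.ball u₀ (r / 2)) :=
      hmaps.mono_left (Icc_subset_Icc hac hdb)
    obtain ⟨hsm, hP⟩ := hp.coord he fun t ht ↦ (hmaps' ht).1
    have hΦs : ContDiff ℝ ∞ fun u ↦ u + f s u • T := by
      have : ContDiff ℝ ∞ fun u ↦ f s u :=
        contDiff_const.mul (contDiff_const.mul ((contDiff_const.mul ℓ.contDiff).exp))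
      exact contDiff_id.add (this.smul contDiff_const)
    refine (smoothPiece_symm_comp he hp.1 (hΦs.comp_contDiffOn hsm)
      fun t ht ↦ (hball (hΦ _ (hmaps' ht).2)).2.1).2 fun t ht ↦ ?_
    have hder := ((hsm t ht).differentiableWithinAt (by simp)).hasDerivWithinAt
    set v := derivWithin (e ∘ σ) (Icc c d) t
    set u := e (σ t) with hu
    have hub : u ∈ Metric.ball u₀ (r / 2) := (hmaps' ht).2
    have h1 : HasDerivWithinAt (fun τ ↦ (e ∘ σ) τ + f s ((e ∘ σ) τ) • T)
        (v + (k * |f s u| * ℓ v) • T) (Icc c d) t := by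
      have h2 : HasDerivWithinAt (fun τ ↦ ℓ ((e ∘ σ) τ)) (ℓ v) (Icc c d) t :=
        ℓ.hasFDerivAt.comp_hasDerivWithinAt t hder
      have h3 := (((h2.const_mul (k * η)).exp.const_mul s).const_mul η).smul_const T
      have h4 := hder.add h3
      refine h4.congr_deriv ?_
      rw [hfabs s u hs0]
      congr 2
      simp only [Function.comp, ← hu]
      linear_combination (s * Real.exp (k * η * ℓ u) * k * ℓ v) * hη2
    have h5 := h1.derivWithin (uniqueDiffOn_Icc hp.1 t ht)
    have hcv : v ≠ 0 := by
      intro h0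
      refine (hP t ht).1 ?_
      change coordFrame e u v = 0
      rw [h0, map_zero]
    have h6 := hdef u v (f s u) (hball (hN _ (hmaps' ht))).1 (hball (hΦ _ hub)).1 (hf0 u) hcv
      (hP t ht).2.1 (hP t ht).2.2
    have h7 : derivWithin ((fun u ↦ u + f s u • T) ∘ e ∘ σ) (Icc c d) t =
        v + (k * |f s u| * ℓ v) • T := h5
    rw [h7]
    exact h6
  · intro w hw
    have hw1 : e w + f s (e w) • T ∈ Metric.ball u₀ δ := (hball (hΦ _ hw.2)).2.2
    have hw2 : e w ∈ Metric.ball u₀ δ := (hball (hN _ hw)).2.2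
    constructor
    · rintro rfl
      have := hseg (e w) hw2 (f s (e w)) (by simp only [f]; positivity) hw1
      rwa [e.left_inv hw.1] at this
    · rintro rfl
      have := hseg _ hw1 (-f s (e w)) (by simp only [f, neg_mul, one_mul, neg_neg]; positivity)
        (by rwa [neg_smul, add_neg_cancel_right])
      rwa [neg_smul, add_neg_cancel_right, e.left_inv hw.1] at this

/-- The relation that `x` and `y` are joined by a causal curve in `N`. -/
def CausalWithin (S : Spacetime n M) (N : Set M) (x y : M) : Prop :=
  ∃ (σ : ℝ → M) (a b : ℝ), PiecewiseSmooth S.IsFutureCausal σ a b ∧ σ a = x ∧ σ b = y ∧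
    MapsTo σ (Icc a b) N

/-- The relation that `I⁺(y) ⊆ I⁺(x)` and `I⁻(x) ⊆ I⁻(y)`. -/
def WeaklyPrecedes (S : Spacetime n M) (x y : M) : Prop :=
  S.chronFuture y ⊆ S.chronFuture x ∧ S.chronPast x ⊆ S.chronPast y

/-- Locally, limits of causally related points are weakly related. -/
theorem exists_nhds_weaklyPrecedes (S : Spacetime n M) (x₀ : M) :
    ∃ N : Set M, IsOpen N ∧ x₀ ∈ N ∧ ∀ w ∈ N, ∀ y ∈ N,
      (w, y) ∈ closure {p : M × M | S.CausalWithin N p.1 p.2} → S.WeaklyPrecedes w y := by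
  obtain ⟨N, hNo, hxN, H⟩ := S.exists_deformation_family x₀
  refine ⟨N, hNo, hxN, fun w hw y hy hcl ↦ ⟨fun q hq ↦ ?_, fun p hp ↦ ?_⟩⟩
  -- First `s` is fixed with `Ψ s y ≪ q`; then a causally related pair `(w', y')` is taken so close
  -- to `(w, y)` that `w ≪ Ψ s w' ≪ Ψ s y' ≪ q`.
  · obtain ⟨Ψ, hlim, hΨ⟩ := H 1 (Or.inl rfl)
    have h1 : ∀ᶠ s in 𝓝[>] (0 : ℝ), Ψ s y ∈ S.chronPast q :=
      hlim y hy ((S.isOpen_chronPast q).mem_nhds hq)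
    obtain ⟨s, hs, hcont, hpw, hchron⟩ := (h1.and hΨ).exists
    have h2 : ∀ᶠ y' in 𝓝 y, Ψ s y' ∈ S.chronPast q :=
      (hcont.continuousAt (hNo.mem_nhds hy)) ((S.isOpen_chronPast q).mem_nhds hs)
    have h3 : ∀ᶠ w' in 𝓝 w, Ψ s w' ∈ S.chronFuture w :=
      (hcont.continuousAt (hNo.mem_nhds hw))
        ((S.isOpen_chronFuture w).mem_nhds ((hchron w hw).1 rfl))
    obtain ⟨⟨w', y'⟩, ⟨hw', hy'⟩, σ, a, b, hσ, rfl, rfl, hmaps⟩ :=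
      mem_closure_iff_nhds.1 hcl _ (prod_mem_nhds h3 h2)
    have h4 : S.Chron (Ψ s (σ a)) (Ψ s (σ b)) := ⟨_, a, b, hpw σ a b hσ hmaps, rfl, rfl⟩
    exact (mem_chronFuture.1 hw').trans (h4.trans hy')
  -- Displacement to the past gives `p ≪ Ψ s w' ≪ Ψ s y' ≪ y` in the same way.
  · obtain ⟨Ψ, hlim, hΨ⟩ := H (-1) (Or.inr rfl)
    have h1 : ∀ᶠ s in 𝓝[>] (0 : ℝ), Ψ s w ∈ S.chronFuture p :=
      hlim w hw ((S.isOpen_chronFuture p).mem_nhds hp)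
    obtain ⟨s, hs, hcont, hpw, hchron⟩ := (h1.and hΨ).exists
    have h2 : ∀ᶠ w' in 𝓝 w, Ψ s w' ∈ S.chronFuture p :=
      (hcont.continuousAt (hNo.mem_nhds hw)) ((S.isOpen_chronFuture p).mem_nhds hs)
    have h3 : ∀ᶠ y' in 𝓝 y, Ψ s y' ∈ S.chronPast y :=
      (hcont.continuousAt (hNo.mem_nhds hy))
        ((S.isOpen_chronPast y).mem_nhds ((hchron y hy).2 rfl))
    obtain ⟨⟨w', y'⟩, ⟨hw', hy'⟩, σ, a, b, hσ, rfl, rfl, hmaps⟩ :=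
      mem_closure_iff_nhds.1 hcl _ (prod_mem_nhds h2 h3)
    have h4 : S.Chron (Ψ s (σ a)) (Ψ s (σ b)) := ⟨_, a, b, hpw σ a b hσ hmaps, rfl, rfl⟩
    exact (mem_chronFuture.1 hw').trans (h4.trans hy')

/-! ### Monotonicity along causal curves -/

theorem WeaklyPrecedes.refl (S : Spacetime n M) (x : M) : S.WeaklyPrecedes x x :=
  ⟨subset_rfl, subset_rfl⟩

theorem WeaklyPrecedes.trans {S : Spacetime n M} {x y z : M} (h : S.WeaklyPrecedes x y)
    (h' : S.WeaklyPrecedes y z) : S.WeaklyPrecedes x z :=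
  ⟨h'.1.trans h.1, h.2.trans h'.2⟩

/-- Points of a continuous causal curve are weakly related. -/
theorem IsContinuousCausalCurve.weaklyPrecedes {S : Spacetime n M} {γ : ℝ → M} {J : Set ℝ}
    (h : S.IsContinuousCausalCurve γ J) {a b : ℝ} (ha : a ∈ J) (hb : b ∈ J) (hab : a ≤ b) :
    S.WeaklyPrecedes (γ a) (γ b) := by
  have hsub : Icc a b ⊆ J := h.1.out ha hb
  have hloc : ∀ t₀ : Icc a b, ∃ V ∈ 𝓝[J] (t₀ : ℝ), ∀ s ∈ V ∩ J, ∀ t ∈ V ∩ J, s ≤ t →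
      S.WeaklyPrecedes (γ s) (γ t) := by
    rintro ⟨t₀, ht₀'⟩
    have ht₀ := hsub ht₀'
    obtain ⟨N, hNo, hN, HN⟩ := S.exists_nhds_weaklyPrecedes (γ t₀)
    obtain ⟨V, hV, HV⟩ := h.2.2 t₀ ht₀ N (hNo.mem_nhds hN)
    refine ⟨V, hV, fun s hs t ht hst ↦ ?_⟩
    rcases hst.eq_or_lt with rfl | hst
    · exact .refl _ _
    · obtain ⟨σ, c, d, hσ, hc, hd, hmaps⟩ := HV s hs t ht hst
      have hcN : γ s ∈ N := hc ▸ hmaps ⟨le_rfl, hσ.1.le⟩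
      have hdN : γ t ∈ N := hd ▸ hmaps ⟨hσ.1.le, le_rfl⟩
      exact HN _ hcN _ hdN (subset_closure ⟨σ, c, d, hσ, hc, hd, hmaps⟩)
  choose V hV HV using hloc
  let c : Icc a b → Set (Icc a b) := fun t ↦ interior ((↑) ⁻¹' V t)
  have hc : ∀ t, t ∈ c t := fun t ↦ by
    refine mem_interior_iff_mem_nhds.2 (preimage_coe_mem_nhds_subtype.2 ?_)
    exact nhdsWithin_mono _ hsub (hV t)
  -- Compactness of `[a, b]` gives a finite subdivision into steps to which the local relation
  -- applies.
  obtain ⟨t, ht0, hmono, ⟨m, hm⟩, hcov⟩ := exists_monotone_Icc_subset_open_cover_Icc hab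
    (fun t ↦ isOpen_interior (s := ((↑) ⁻¹' V t : Set (Icc a b))))
    (fun t _ ↦ mem_iUnion.2 ⟨t, hc t⟩)
  have key : ∀ i, S.WeaklyPrecedes (γ a) (γ (t i)) := by
    intro i
    induction i with
    | zero => rw [ht0]; exact .refl _ _
    | succ i ih =>
      obtain ⟨j, hj⟩ := hcov i
      have hle := hmono (Nat.le_succ i)
      have h1 : t i ∈ ((↑) ⁻¹' V j : Set (Icc a b)) := interior_subset (hj ⟨le_rfl, hle⟩)
      have h2 : t (i + 1) ∈ ((↑) ⁻¹' V j : Set (Icc a b)) := interior_subset (hj ⟨hle, le_rfl⟩)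
      exact ih.trans (HV j _ ⟨h1, hsub (t i).2⟩ _ ⟨h2, hsub (t (i + 1)).2⟩ hle)
  have := key m
  rwa [hm m le_rfl] at this

end Spacetime

namespace Spacetime

variable {n : ℕ} {M : Type*} [TopologicalSpace M]
  [ChartedSpace (EuclideanSpace ℝ (Fin (n + 1))) M] [IsManifold (𝓡 (n + 1)) ∞ M]

/-! ### The volume of open sets and of boundaries of pasts -/

section Volume

variable {S : Spacetime n M} {e : OpenPartialHomeomorph M (EuclideanSpace ℝ (Fin (n + 1)))}

theorem gram_apply (u : EuclideanSpace ℝ (Fin (n + 1))) (i j : Fin (n + 1)) :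
    S.gram e u i j = S.coordMetric e u (EuclideanSpace.single i 1) (EuclideanSpace.single j 1) :=
  rfl

/-- A kernel vector would be orthogonal to everything: nonzero, null and orthogonal to the timelike
`timeField`, which is impossible. -/
theorem det_gram_ne_zero (he : e ∈ IsManifold.maximalAtlas (𝓡 (n + 1)) ∞ M)
    {u : EuclideanSpace ℝ (Fin (n + 1))} (hu : u ∈ e.target) : (S.gram e u).det ≠ 0 := by
  intro h0
  obtain ⟨v, hv, hv0⟩ := Matrix.exists_mulVec_eq_zero_iff.2 h0
  let W : EuclideanSpace ℝ (Fin (n + 1)) := WithLp.toLp 2 v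
  have hsum : ∀ w : EuclideanSpace ℝ (Fin (n + 1)),
      w = ∑ j, w j • EuclideanSpace.single j (1 : ℝ) := fun w ↦ by
    simpa using ((EuclideanSpace.basisFun (Fin (n + 1)) ℝ).sum_repr w).symm
  have h1 : ∀ i, S.coordMetric e u (EuclideanSpace.single i 1) W = 0 := by
    intro i
    have := congrFun hv0 i
    rw [Matrix.mulVec, dotProduct] at this
    rw [hsum W]
    simp only [map_sum, map_smul, smul_eq_mul]
    rw [← this.trans (Pi.zero_apply i)]
    exact Finset.sum_congr rfl fun j _ ↦ by rw [gram_apply, mul_comm]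
  have h2 : ∀ w, S.coordMetric e u w W = 0 := by
    intro w
    rw [hsum w]
    simp only [map_sum, map_smul, _root_.sum_apply, _root_.smul_apply, h1, smul_zero,
      Finset.sum_const_zero]
  have hW : W ≠ 0 := fun h ↦ hv (by simpa [W] using congrArg (WithLp.ofLp) h)
  have hFW : coordFrame e u W ≠ 0 := fun h ↦
    hW ((coordFrame_bijective he hu).1 (h.trans (map_zero _).symm))
  obtain ⟨T, hT⟩ := S.exists_coordFrame_eq_timeField he hu
  refine S.metric_pos_of_orthogonal (S.timeField_timelike (e.symm u)) (h2 W).le hFW ?_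
  have h3 : S.coordMetric e u W T = 0 := coordMetric_symm.trans (h2 T)
  rwa [coordMetric_apply, hT] at h3

theorem continuousOn_density (he : e ∈ IsManifold.maximalAtlas (𝓡 (n + 1)) ∞ M) :
    ContinuousOn (S.density e) e.target := by
  have hG := (contDiffOn_coordMetric (S := S) he).continuousOn
  have h1 : ContinuousOn (fun u ↦ S.gram e u) e.target := by
    refine continuousOn_pi.2 fun i ↦ continuousOn_pi.2 fun j ↦ ?_
    exact (hG.clm_apply continuousOn_const).clm_apply continuousOn_const
  have h2 : ContinuousOn (fun u ↦ (S.gram e u).det) e.target :=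
    (continuous_id.matrix_det).comp_continuousOn h1
  exact ENNReal.continuous_ofReal.comp_continuousOn
    (Real.continuous_sqrt.comp_continuousOn h2.abs)

variable [MeasurableSpace M] [BorelSpace M]

/-- The density is positive in a chart, and nonempty open sets have positive Lebesgue measure. -/
theorem vol_pos_of_isOpen (S : Spacetime n M) {U : Set M} (hU : IsOpen U) (hne : U.Nonempty) :
    0 < S.vol U := by
  obtain ⟨z, hz⟩ := hne
  let e := chartAt (EuclideanSpace ℝ (Fin (n + 1))) z
  have he : e ∈ IsManifold.maximalAtlas (𝓡 (n + 1)) ∞ M :=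
    IsManifold.chart_mem_maximalAtlas _
  have hze : z ∈ e.source := mem_chart_source _ _
  have hA : IsOpen (U ∩ e.source) := hU.inter e.open_source
  refine lt_of_lt_of_le ?_ (measure_mono (inter_subset_left : U ∩ e.source ⊆ U))
  rw [S.vol_apply he hA.measurableSet inter_subset_right, pos_iff_ne_zero]
  set O := e.target ∩ e.symm ⁻¹' (U ∩ e.source)
  have hO : IsOpen O := e.isOpen_inter_preimage_symm hA
  intro h0
  rw [lintegral_eq_zero_iff' (((continuousOn_density he).mono inter_subset_left).aemeasurable
    hO.measurableSet)] at h0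
  have h1 : ∀ᵐ u ∂(volume.restrict O), False := by
    filter_upwards [h0, ae_restrict_mem hO.measurableSet] with u hu huO
    have : 0 < S.density e u := ENNReal.ofReal_pos.2
      (Real.sqrt_pos.2 (abs_pos.2 (det_gram_ne_zero he huO.1)))
    exact this.ne' hu
  rw [eventually_false_iff_eq_bot, ae_eq_bot, Measure.restrict_eq_zero] at h1
  refine (hO.measure_pos volume ⟨e z, e.map_source hze, ?_⟩).ne' h1
  rw [mem_preimage, e.left_inv hze]
  exact ⟨hz, hze⟩

/-- The boundary of a chronological past has volume zero. -/
theorem vol_closure_chronPast_sdiff [SecondCountableTopology M] (S : Spacetime n M) (x : M) :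
    S.vol (closure (S.chronPast x) \ S.chronPast x) = 0 := by
  set F := closure (S.chronPast x) \ S.chronPast x with hF
  -- The boundary is achronal, hence meets each timelike coordinate line in a small ball at most
  -- once.
  have hach : ∀ z ∈ F, ∀ z' ∈ F, ¬ S.Chron z z' := by
    intro z hz z' hz' h
    obtain ⟨y, hy1, hy2⟩ := mem_closure_iff_nhds.1 hz'.1 _ ((S.isOpen_chronFuture z).mem_nhds h)
    exact hz.2 (Chron.trans hy1 hy2)
  refine measure_null_of_locally_null _ fun z _ ↦ ?_
  let e := chartAt (EuclideanSpace ℝ (Fin (n + 1))) z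
  have he : e ∈ IsManifold.maximalAtlas (𝓡 (n + 1)) ∞ M :=
    IsManifold.chart_mem_maximalAtlas _
  have hze : z ∈ e.source := mem_chart_source _ _
  obtain ⟨T, -, δ, hδ, H⟩ := S.exists_chron_of_sub_eq_smul he (e.map_source hze)
  set W := e.source ∩ e ⁻¹' Metric.ball (e z) δ with hW
  have hWo : IsOpen W := e.isOpen_inter_preimage Metric.isOpen_ball
  have hzW : z ∈ W := ⟨hze, Metric.mem_ball_self hδ⟩
  have hFm : MeasurableSet F := isClosed_closure.measurableSet.diff
    (S.isOpen_chronPast x).measurableSet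
  refine ⟨F ∩ W, inter_mem self_mem_nhdsWithin (mem_nhdsWithin_of_mem_nhds (hWo.mem_nhds hzW)), ?_⟩
  rw [S.vol_apply he (hFm.inter hWo.measurableSet) fun y hy ↦ hy.2.1]
  refine setLIntegral_measure_zero _ _ ?_
  set A := e.target ∩ e.symm ⁻¹' (F ∩ W) with hA
  -- `e.symm` is only known to be continuous on `e.target`, so `A` is built from preimages of open
  -- sets inside it.
  have hAm : MeasurableSet A := by
    have : A = ((e.target ∩ e.symm ⁻¹' W) \ (e.target ∩ e.symm ⁻¹' (closure (S.chronPast x))ᶜ)) \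
        (e.target ∩ e.symm ⁻¹' S.chronPast x) := by
      ext u
      simp only [hA, hF, mem_inter_iff, mem_preimage, Set.mem_sdiff, mem_compl_iff]
      tauto
    rw [this]
    exact (((e.isOpen_inter_preimage_symm hWo).measurableSet.diff
      (e.isOpen_inter_preimage_symm isClosed_closure.isOpen_compl).measurableSet).diff
      (e.isOpen_inter_preimage_symm (S.isOpen_chronPast x)).measurableSet)
  have hAb : ∀ u ∈ A, u ∈ Metric.ball (e z) δ := by
    rintro u ⟨hu, -, hu'⟩
    have := hu'.2
    rwa [mem_preimage, e.right_inv hu] at this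
  have hno : ∀ u ∈ A, ∀ s : ℝ, 0 < s → u + s • T ∉ A := fun u hu s hs hu' ↦
    hach _ hu.2.1 _ hu'.2.1 (H u (hAb u hu) s hs (hAb _ hu'))
  have hno' : ∀ u ∈ A, ∀ s : ℝ, s ≠ 0 → u + s • T ∉ A := fun u hu s hs hu' ↦ by
    rcases lt_or_gt_of_ne hs with h | h
    · exact hno _ hu' (-s) (neg_pos.2 h) (by rwa [neg_smul, add_neg_cancel_right])
    · exact hno u hu s h hu'
  -- Infinitely many translates of `A` along `T`, by bounded amounts, are disjoint, which forces
  -- measure zero.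
  refine Measure.addHaar_eq_zero_of_disjoint_translates volume
    (fun i : ℕ ↦ (1 / ((i : ℝ) + 1)) • T) ?_ ?_ hAm
  · have : Tendsto (fun i : ℕ ↦ (1 / ((i : ℝ) + 1)) • T) atTop (𝓝 ((0 : ℝ) • T)) :=
      tendsto_one_div_add_atTop_nhds_zero_nat.smul_const T
    exact Metric.isBounded_range_of_tendsto _ this
  · intro i j hij
    refine disjoint_left.2 ?_
    rintro y hy hy'
    simp only [singleton_add, mem_image] at hy hy'
    obtain ⟨u, hu, rfl⟩ := hy
    obtain ⟨u', hu', h⟩ := hy'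
    refine hno' u hu (1 / ((i : ℝ) + 1) - 1 / ((j : ℝ) + 1)) ?_ ?_
    · rw [sub_ne_zero]
      intro h
      rw [one_div, one_div, inv_inj, add_left_inj, Nat.cast_inj] at h
      exact hij h
    · have : u + (1 / ((i : ℝ) + 1) - 1 / ((j : ℝ) + 1)) • T = u' := by
        rw [sub_smul, ← add_sub_assoc, sub_eq_iff_eq_add, add_comm u, ← h, add_comm u']
      rwa [this]

end Volume

end Spacetime

namespace Spacetime

variable {n : ℕ} {M : Type*} [TopologicalSpace M]
  [ChartedSpace (EuclideanSpace ℝ (Fin (n + 1))) M] [IsManifold (𝓡 (n + 1)) ∞ M]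

/-! ### Past reflection -/

/-- A timelike curve that enters an open set does so at a boundary point. -/
theorem Chron.exists_entrance {S : Spacetime n M} {x y : M} (h : S.Chron x y) {O : Set M}
    (hO : IsOpen O) (hx : x ∉ O) (hy : y ∈ O) :
    ∃ p ∈ closure O \ O, S.chronFuture p ⊆ S.chronFuture x ∧ S.CausalWithin (closure O) p y := by
  obtain ⟨γ, a, b, hγ, rfl, rfl⟩ := h
  have hc := hγ.continuousOn
  have hK : IsCompact (Icc a b ∩ γ ⁻¹' Oᶜ) :=
    isCompact_Icc.of_isClosed_subset (hc.preimage_isClosed_of_isClosed isClosed_Icc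
      hO.isClosed_compl) inter_subset_left
  -- The last parameter outside `O`, so that the remaining arc stays in the closure of `O`.
  obtain ⟨t, ⟨htI, htO⟩, hmax⟩ := hK.exists_isGreatest ⟨a, ⟨le_rfl, hγ.1.le⟩, hx⟩
  have htb : t < b := lt_of_le_of_ne htI.2 (by rintro rfl; exact htO hy)
  have hin : MapsTo γ (Ioc t b) O := fun s hs ↦ by
    by_contra hsO
    exact absurd (hmax ⟨⟨htI.1.trans hs.1.le, hs.2⟩, hsO⟩) (not_le.2 hs.1)
  have htcl : γ t ∈ closure O := by
    have h1 : ContinuousWithinAt γ (Ioc t b) t :=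
      (hc t htI).mono fun s hs ↦ ⟨htI.1.trans hs.1.le, hs.2⟩
    refine h1.mem_closure ?_ hin
    rw [closure_Ioc htb.ne]
    exact ⟨le_rfl, htb.le⟩
  refine ⟨γ t, ⟨htcl, htO⟩, ?_, γ, t, b, ?_, rfl, rfl, fun s hs ↦ ?_⟩
  · rcases htI.1.eq_or_lt with rfl | hat
    · exact subset_rfl
    · exact fun q hq ↦ Chron.trans ⟨γ, a, t, hγ.mono le_rfl hat htI.2, rfl, rfl⟩ hq
  · exact (hγ.mono htI.1 htb le_rfl).imp fun _ _ h ↦ h.isFutureCausal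
  · rcases hs.1.eq_or_lt with rfl | hts
    · exact htcl
    · exact subset_closure (hin ⟨hts, hs.2⟩)

/-- Every point `z ≠ x` has a neighbourhood that can be left towards the past, without leaving the
closure of the future of `x`. -/
theorem exists_nhds_escape [T2Space M] [SecondCountableTopology M] (S : Spacetime n M) {x z : M}
    (hzx : z ≠ x) :
    ∃ O : Set M, IsOpen O ∧ z ∈ O ∧ ∀ w ∈ O, S.chronFuture w ⊆ S.chronFuture x →
      ∃ w' ∉ O, S.chronFuture w' ⊆ S.chronFuture x ∧ S.WeaklyPrecedes w' w := by
  have : LocallyCompactSpace M :=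
    ChartedSpace.locallyCompactSpace (EuclideanSpace ℝ (Fin (n + 1))) M
  obtain ⟨N, hNo, hzN, hN⟩ := S.exists_nhds_weaklyPrecedes z
  obtain ⟨K, hK, hKN, hKc⟩ := local_compact_nhds (inter_mem (hNo.mem_nhds hzN)
    (isOpen_compl_singleton.mem_nhds hzx))
  have hcl : closure (interior K) ⊆ K := closure_minimal interior_subset hKc.isClosed
  have hxO : x ∉ interior K := fun h ↦ (hKN (interior_subset h)).2 rfl
  refine ⟨interior K, isOpen_interior, mem_interior_iff_mem_nhds.2 hK, fun w hw hwx ↦ ?_⟩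
  -- `w` need not lie in `I⁺(x)`, but it is a limit of points that do; their timelike curves from
  -- `x` supply the entrance points.
  have hw' : w ∈ closure (interior K ∩ S.chronFuture x) :=
    isOpen_interior.inter_closure ⟨hw, closure_mono hwx (S.mem_closure_chron w).1⟩
  obtain ⟨y, hy, hyw⟩ := mem_closure_iff_seq_limit.1 hw'
  have hex := fun k ↦ Chron.exists_entrance (mem_chronFuture.1 (hy k).2) isOpen_interior hxO
    (hy k).1
  choose p hp hpx hpy using hex
  have hcpt : IsCompact (closure (interior K) \ interior K) :=
    (hKc.of_isClosed_subset isClosed_closure hcl).diff isOpen_interior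
  obtain ⟨w', hw'K, φ, hφ, hlim⟩ := hcpt.tendsto_subseq hp
  refine ⟨w', hw'K.2, fun q hq ↦ ?_, ?_⟩
  · obtain ⟨k, hk⟩ := (hlim.eventually_mem ((S.isOpen_chronPast q).mem_nhds hq)).exists
    exact hpx _ hk
  · refine hN w' (hKN (hcl hw'K.1)).1 w (hKN (interior_subset hw)).1 ?_
    refine mem_closure_of_tendsto (hlim.prodMk_nhds (hyw.comp hφ.tendsto_atTop))
      (Eventually.of_forall fun k ↦ ?_)
    obtain ⟨σ, a, b, h1, h2, h3, h4⟩ := hpy (φ k)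
    exact ⟨σ, a, b, h1, h2, h3, fun s hs ↦ (hKN (hcl (h4 hs))).1⟩

/-- If past reflection fails for `x` and `y`, then there is a weakly descending sequence in the
closure of the future of `x` without limit. -/
theorem exists_seq_not_tendsto [T2Space M] [SecondCountableTopology M] (S : Spacetime n M)
    {x y : M} (h : S.chronFuture y ⊆ S.chronFuture x) (hn : ¬ S.chronPast x ⊆ S.chronPast y) :
    ∃ w : ℕ → M, (∀ i, S.chronFuture (w i) ⊆ S.chronFuture x) ∧
      (∀ i, S.WeaklyPrecedes (w (i + 1)) (w i)) ∧ ¬ ∃ p, Tendsto w atTop (𝓝 p) := by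
  have hyx : y ≠ x := by
    rintro rfl
    exact hn subset_rfl
  choose! O hOo hzO hO using fun z (hz : z ≠ x) ↦ S.exists_nhds_escape hz
  obtain ⟨t, ht, htc, htU⟩ := TopologicalSpace.countable_cover_nhdsWithin (f := O)
    (s := {x}ᶜ) fun z hz ↦ mem_nhdsWithin_of_mem_nhds ((hOo z hz).mem_nhds (hzO z hz))
  have htne : t.Nonempty := by
    obtain ⟨z, hz, -⟩ := mem_iUnion₂.1 (htU hyx)
    exact ⟨z, hz⟩
  obtain ⟨z, rfl⟩ := htc.exists_eq_range htne
  -- Both conditions survive a step back: the first permits the next escape, the second excludes `x`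
  -- as a limit.
  let C := {w : M // S.chronFuture w ⊆ S.chronFuture x ∧ S.chronPast w ⊆ S.chronPast y}
  have hstep : ∀ (j : ℕ) (w : C), ∃ w' : C, S.WeaklyPrecedes w'.1 w.1 ∧ w'.1 ∉ O (z j) := by
    rintro j ⟨w, hw1, hw2⟩
    by_cases hw : w ∈ O (z j)
    · obtain ⟨w', h1, h2, h3⟩ := hO (z j) (ht ⟨j, rfl⟩) w hw hw1
      exact ⟨⟨w', h2, h3.2.trans hw2⟩, h3, h1⟩
    · exact ⟨⟨w, hw1, hw2⟩, .refl _ _, hw⟩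
  choose step hs1 hs2 using hstep
  -- The first component of `Nat.unpair` takes every value infinitely often, so each `O (z j)` is
  -- avoided infinitely often.
  let w : ℕ → C := fun i ↦ Nat.rec ⟨y, h, subset_rfl⟩ (fun i w ↦ step (Nat.unpair i).1 w) i
  have hw : ∀ i, w (i + 1) = step (Nat.unpair i).1 (w i) := fun i ↦ rfl
  refine ⟨fun i ↦ (w i).1, fun i ↦ (w i).2.1, fun i ↦ ?_, ?_⟩
  · exact hs1 _ _
  · rintro ⟨p, hp⟩
    by_cases hpx : p = x
    · subst hpx
      refine hn fun q hq ↦ ?_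
      obtain ⟨i, hi⟩ := (hp.eventually_mem ((S.isOpen_chronFuture q).mem_nhds hq)).exists
      exact (w i).2.2 hi
    · obtain ⟨_, ⟨j, rfl⟩, hj⟩ := mem_iUnion₂.1 (htU hpx)
      have hev := (tendsto_add_atTop_iff_nat 1).2 hp
        ((hOo (z j) (ht ⟨j, rfl⟩)).mem_nhds hj)
      obtain ⟨k, hk⟩ := eventually_atTop.1 (mem_map.1 hev)
      have h1 := hk (Nat.pair j k) (Nat.right_le_pair j k)
      rw [hw, Nat.unpair_pair] at h1
      exact hs2 _ _ h1

/-- A weakly descending sequence without limit is accompanied by a chronologically descending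
sequence without limit. -/
theorem exists_chron_seq_not_tendsto [T2Space M] [SecondCountableTopology M] (S : Spacetime n M)
    {w : ℕ → M} (hw : ∀ i, S.WeaklyPrecedes (w (i + 1)) (w i))
    (hlim : ¬ ∃ p, Tendsto w atTop (𝓝 p)) :
    ∃ q : ℕ → M, (∀ i, S.Chron (w i) (q i)) ∧ (∀ i, S.Chron (q (i + 1)) (q i)) ∧
      ¬ ∃ p, Tendsto q atTop (𝓝 p) := by
  have : LocallyCompactSpace M :=
    ChartedSpace.locallyCompactSpace (EuclideanSpace ℝ (Fin (n + 1))) M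
  let _ := TopologicalSpace.metrizableSpaceMetric M
  -- From `w i ≪ q` follows `w (i + 1) ≪ q`, so there is room for `q'` strictly between, as close to
  -- `w (i + 1)` as desired. A limit of the new sequence would then be a limit of `w`.
  have hstep : ∀ (i : ℕ) (q : {q // S.Chron (w i) q}), ∃ q' : {q // S.Chron (w (i + 1)) q},
      S.Chron q'.1 q.1 ∧ dist q'.1 (w (i + 1)) < 1 / ((i : ℝ) + 1) := by
    rintro i ⟨q, hq⟩
    have hq' : w (i + 1) ∈ S.chronPast q := (hw i).1 hq
    obtain ⟨q', ⟨h1, h2⟩, h3⟩ := mem_closure_iff_nhds.1 (S.mem_closure_chron (w (i + 1))).1 _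
      (inter_mem ((S.isOpen_chronPast q).mem_nhds hq')
        (Metric.ball_mem_nhds _ (by positivity : 0 < 1 / ((i : ℝ) + 1))))
    exact ⟨⟨q', h3⟩, h1, h2⟩
  choose step hs1 hs2 using hstep
  obtain ⟨q₀, hq₀⟩ : (S.chronFuture (w 0)).Nonempty :=
    closure_nonempty_iff.1 ⟨_, (S.mem_closure_chron (w 0)).1⟩
  let q : ∀ i, {q // S.Chron (w i) q} := fun i ↦ Nat.rec ⟨q₀, hq₀⟩ (fun i q ↦ step i q) i
  have hq : ∀ i, q (i + 1) = step i (q i) := fun i ↦ rfl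
  refine ⟨fun i ↦ (q i).1, fun i ↦ (q i).2, fun i ↦ ?_, ?_⟩
  · exact hs1 _ _
  · rintro ⟨p, hp⟩
    refine hlim ⟨p, (tendsto_add_atTop_iff_nat 1).1 ?_⟩
    have hd : Tendsto (fun i ↦ dist (q (i + 1)).1 (w (i + 1))) atTop (𝓝 0) :=
      squeeze_zero (fun _ ↦ dist_nonneg) (fun i ↦ (hq i ▸ hs2 i (q i)).le)
        tendsto_one_div_add_atTop_nhds_zero_nat
    exact (tendsto_iff_of_dist hd).1 ((tendsto_add_atTop_iff_nat 1).2 hp)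

/-- A chronologically descending sequence without limit lies on a past-inextendible curve. -/
theorem exists_isPastInextendible_of_seq (S : Spacetime n M) {q : ℕ → M}
    (hq : ∀ i, S.Chron (q (i + 1)) (q i)) (hlim : ¬ ∃ p, Tendsto q atTop (𝓝 p)) :
    ∃ (γ : ℝ → M) (J : Set ℝ) (s : ℕ → J), S.IsPastInextendible γ J ∧
      Tendsto s atTop atBot ∧ ∀ i, γ (s i) = q i := by
  obtain ⟨γ, s, hs, hγ, hpw⟩ := exists_curve_of_chron_seq hq
  -- `J` has no least element, and the break points are cofinal towards its left end even if they
  -- are bounded below in `ℝ`.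
  let J : Set ℝ := {t | ∃ i, t ∈ Icc (s i) (s 0)}
  have hsJ : ∀ i, s i ∈ J := fun i ↦ ⟨i, le_rfl, hs.antitone (Nat.zero_le i)⟩
  have htend : Tendsto (fun i ↦ (⟨s i, hsJ i⟩ : J)) atTop atBot := by
    refine tendsto_atBot.2 ?_
    rintro ⟨t, i, hi⟩
    filter_upwards [eventually_ge_atTop i] with j hj
    exact (hs.antitone hj).trans hi.1
  refine ⟨γ, J, fun i ↦ ⟨s i, hsJ i⟩, ⟨⟨⟨?_⟩, ?_⟩, ?_⟩, htend, hγ⟩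
  · rintro a ⟨i, hi⟩ b ⟨j, hj⟩ c hc
    exact ⟨i, hi.1.trans hc.1, hc.2.trans hj.2⟩
  · rintro a ⟨i, hi⟩ b ⟨j, hj⟩ hab
    have key : ∀ i, PiecewiseSmooth S.IsFutureTimelike γ (s (i + 1)) (s 0) := by
      intro i
      induction i with
      | zero => exact hpw 0
      | succ i ih => exact (hpw (i + 1)).trans ih
    refine ((key i).mono ((hs (Nat.lt_succ_self i)).le.trans hi.1) hab hj.2).imp
      fun _ _ h ↦ h.isFutureCausal
  · rintro ⟨p, hp⟩
    refine hlim ⟨p, (hp.comp htend).congr hγ⟩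

variable [MeasurableSpace M] [BorelSpace M]

theorem cosmologicalVolume_pos (S : Spacetime n M) (x : M) : 0 < S.cosmologicalVolume x :=
  S.vol_pos_of_isOpen (S.isOpen_chronPast x)
    (closure_nonempty_iff.1 ⟨x, (S.mem_closure_chron x).2⟩)

theorem HasRegularCosmologicalVolume.isPastReflecting [T2Space M] [SecondCountableTopology M]
    {S : Spacetime n M} (hS : S.HasRegularCosmologicalVolume) : S.IsPastReflecting := by
  intro x y h
  by_contra hn
  obtain ⟨w, hwx, hw, hwlim⟩ := S.exists_seq_not_tendsto h hn
  obtain ⟨q, hwq, hq, hqlim⟩ := S.exists_chron_seq_not_tendsto hw hwlim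
  obtain ⟨γ, J, s, hγ, hs, hγq⟩ := S.exists_isPastInextendible_of_seq hq hqlim
  have h0 := (hS.2 γ J hγ).comp hs
  refine (S.cosmologicalVolume_pos x).not_ge (ge_of_tendsto' h0 fun i ↦ ?_)
  simp only [Function.comp, hγq]
  have hxq : S.Chron x (q i) := hwx i (hwq i)
  exact measure_mono fun z hz ↦ Chron.trans hz hxq

/-! ### Continuity -/

/-- Continuity of the measure from below. The approximating points of `I⁻(x)` need not be ordered,
so finite unions of their pasts are used; points near `x` lie in the future of finitely many of
them. -/
theorem eventually_lt_cosmologicalVolume [SecondCountableTopology M] (S : Spacetime n M) {x : M}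
    {c : ℝ≥0∞} (hc : c < S.cosmologicalVolume x) : ∀ᶠ y in 𝓝 x, c < S.cosmologicalVolume y := by
  obtain ⟨p, hp, hpx⟩ := mem_closure_iff_seq_limit.1 (S.mem_closure_chron x).2
  have hU : S.chronPast x ⊆ ⋃ i, S.chronPast (p i) := fun z hz ↦ by
    obtain ⟨i, hi⟩ := (hpx.eventually_mem ((S.isOpen_chronFuture z).mem_nhds hz)).exists
    exact mem_iUnion.2 ⟨i, hi⟩
  have hlim := tendsto_measure_iUnion_accumulate (μ := S.vol) (f := fun i ↦ S.chronPast (p i))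
  obtain ⟨i, hi⟩ := (hlim.eventually_const_lt (hc.trans_le (measure_mono hU))).exists
  have hev : ∀ᶠ y in 𝓝 x, ∀ j ∈ Iic i, y ∈ S.chronFuture (p j) :=
    (eventually_all_finite (finite_Iic i)).2 fun j _ ↦
      (S.isOpen_chronFuture (p j)).mem_nhds (hp j)
  filter_upwards [hev] with y hy
  refine hi.trans_le (measure_mono fun z hz ↦ ?_)
  obtain ⟨j, hj, hzj⟩ := mem_accumulate.1 hz
  exact Chron.trans hzj (hy j hj)

theorem HasRegularCosmologicalVolume.eventually_cosmologicalVolume_lt [T2Space M]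
    [SecondCountableTopology M] {S : Spacetime n M} (hS : S.HasRegularCosmologicalVolume) {x : M}
    {c : ℝ≥0∞} (hc : S.cosmologicalVolume x < c) :
    ∀ᶠ y in 𝓝 x, S.cosmologicalVolume y < c := by
  obtain ⟨q, hq, hqx⟩ := mem_closure_iff_seq_limit.1 (S.mem_closure_chron x).1
  let D : ℕ → Set M := fun i ↦ ⋂ j ∈ Iic i, S.chronPast (q j)
  have hD : ⋂ i, D i ⊆ S.chronPast x ∪ (closure (S.chronPast x) \ S.chronPast x) := by
    intro z hz
    have hzq : ∀ i, S.Chron z (q i) := fun i ↦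
      mem_iInter₂.1 (mem_iInter.1 hz i) i (mem_Iic.2 le_rfl)
    -- Past reflection enters here: it turns this inclusion into `I⁻(z) ⊆ I⁻(x)`, and `z` is a limit
    -- of points of its own past.
    have hzx : S.chronFuture x ⊆ S.chronFuture z := fun r hr ↦ by
      obtain ⟨i, hi⟩ := (hqx.eventually_mem ((S.isOpen_chronPast r).mem_nhds hr)).exists
      exact (hzq i).trans hi
    rw [union_sdiff_self]
    exact Or.inr (closure_mono (hS.isPastReflecting z x hzx) (S.mem_closure_chron z).2)
  have hvol : S.vol (⋂ i, D i) ≤ S.cosmologicalVolume x := by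
    refine (measure_mono hD).trans ((measure_union_le _ _).trans ?_)
    rw [S.vol_closure_chronPast_sdiff, add_zero]
    exact le_rfl
  -- Continuity from above needs one set of finite measure; finiteness of `τ` at `q 0` provides it.
  have hfin : S.vol (D 0) ≠ ⊤ := by
    refine ((measure_mono ?_).trans_lt (hS.1 (q 0))).ne
    exact biInter_subset_of_mem (mem_Iic.2 le_rfl)
  have hlim := tendsto_measure_iInter_atTop (μ := S.vol) (s := D)
    (fun i ↦ (((finite_Iic i).isOpen_biInter fun j _ ↦
      S.isOpen_chronPast (q j)).measurableSet).nullMeasurableSet)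
    (fun i j hij ↦ biInter_subset_biInter_left (Iic_subset_Iic.2 hij)) ⟨0, hfin⟩
  obtain ⟨i, hi⟩ := (hlim.eventually_lt_const (hvol.trans_lt hc)).exists
  have hev : ∀ᶠ y in 𝓝 x, ∀ j ∈ Iic i, y ∈ S.chronPast (q j) :=
    (eventually_all_finite (finite_Iic i)).2 fun j _ ↦
      (S.isOpen_chronPast (q j)).mem_nhds (hq j)
  filter_upwards [hev] with y hy
  refine (measure_mono fun z hz ↦ ?_).trans_lt hi
  exact mem_iInter₂.2 fun j hj ↦ Chron.trans hz (hy j hj)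

end Spacetime

end

theorem mainTheorem8 {n : ℕ} {M : Type*} [TopologicalSpace M] [T2Space M]
    [SecondCountableTopology M] [ChartedSpace (EuclideanSpace ℝ (Fin (n + 1))) M]
    [IsManifold (𝓡 (n + 1)) ∞ M] [MeasurableSpace M] [BorelSpace M]
    (S : Spacetime n M) (hS : S.HasRegularCosmologicalVolume) :
    Continuous S.cosmologicalVolume ∧
    (∀ (γ : ℝ → M) (J : Set ℝ), S.IsContinuousCausalCurve γ J →
      MonotoneOn (fun t ↦ S.cosmologicalVolume (γ t)) J) ∧
    S.IsPastReflecting := by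
  refine ⟨?_, fun γ J hγ a ha b hb hab ↦ measure_mono (hγ.weaklyPrecedes ha hb hab).2,
    hS.isPastReflecting⟩
  exact continuous_iff_continuousAt.2 fun x ↦ tendsto_order.2
    ⟨fun c hc ↦ S.eventually_lt_cosmologicalVolume hc,
      fun c hc ↦ hS.eventually_cosmologicalVolume_lt hc⟩
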